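/- Let $k$ be a field, let $a,b\ge 2$ be integers, and let $q\in k$ be a nonzero element which is not a root of unity (that is, $q^m\neq 1$ for all integers $m\ge 1$). Let $$A = k\langle X,Y\rangle/(X^a,\; XY-qYX,\; Y^b).$$ Write $D(A)=\operatorname{Hom}_k(A,k)$, a left $A$-module via $(x\cdot h)(y)=h(yx)$. If $\phi\colon A\to D(A)$ is an isomorphism of left $A$-modules, a $k$-algebra automorphism $\nu$ of $A$ is called the Nakayama automorphism of $A$ with respect to $\phi$ if $\phi(1)(\lambda x)=\phi(1)(\nu(x)\lambda)$ for all $\lambda,x\in A$. Such a pair $(\phi,\nu)$ exists, and for every such pair $$\operatorname{HH}_n(A,\,{}_{\nu^{-1}}A_1)=0\qquad\text{for all } n\ge 1 .$$ Here ${}_{\nu^{-1}}A_1$ is the $A$-$A$-bimodule with underlying space $A$, left action $\lambda\cdot m=\nu^{-1}(\lambda)m$ and the usual right action. For an $A$-$A$-bimodule $B$, $\operatorname{HH}_n(A,B)$ denotes the degree $n$ homology of the Hochschild complex with terms $B\otimes_k A^{\otimes n}$ ($n\ge 0$) and differential $$\partial_n(b\otimes\lambda_1\otimes\cdots\otimes\lambda_n)=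 b\lambda_1\otimes\lambda_2\otimes\cdots\otimes\lambda_n+\sum_{i=1}^{n-1}(-1)^i\, b\otimes\lambda_1\otimes\cdots\otimes\lambda_i\lambda_{i+1}\otimes\cdots\otimes\lambda_n+(-1)^n\lambda_n b\otimes\lambda_1\otimes\cdots\otimes\lambda_{n-1}.$$ -/

import Mathlib

open scoped TensorProduct

/-! ### Hochschild homology with coefficients in a bimodule -/

theorem contractNth_castSucc_update {Λ : Type*} [Mul Λ] {n : ℕ} (j : Fin n)
    (f : Fin (n + 1) → Λ) (i : Fin (n + 1)) (v : Λ) :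
    Fin.contractNth j.castSucc (· * ·) (Function.update f i v) =
      Function.update (Fin.contractNth j.castSucc (· * ·) f) (j.predAbove i)
        (if i = j.castSucc then v * f j.succ else if i = j.succ then f j.castSucc * v else v) := by
  have hp : ((j.predAbove i : Fin n) : ℕ) = if (j : ℕ) < i then (i : ℕ) - 1 else i := by
    unfold Fin.predAbove
    simp only [Fin.lt_def, Fin.val_castSucc]
    split_ifs <;> rfl
  funext l
  generalize j.predAbove i = p at hp
  obtain ⟨i, hi⟩ := i
  obtain ⟨j, hj⟩ := j
  obtain ⟨l, hl⟩ := l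
  obtain ⟨p, hp'⟩ := p
  simp only [Fin.contractNth, Function.update_apply, Fin.ext_iff, Fin.val_castSucc,
    Fin.val_succ] at hp ⊢
  split_ifs at hp ⊢ <;> first | rfl | omega | (subst_vars; rfl)

section Hochschild

variable (k Λ B : Type*) [CommRing k] [Ring Λ] [Algebra k Λ]
  [AddCommGroup B] [Module k B] [Module Λ B] [Module Λᵐᵒᵖ B]
  [IsScalarTower k Λ B] [IsScalarTower k Λᵐᵒᵖ B]

/-- The degree `n` term `B ⊗ Λ ⊗ ⋯ ⊗ Λ` (`n` factors `Λ`) of the Hochschild homology complex. -/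
abbrev HochschildChain (n : ℕ) : Type _ := B ⊗[k] (⨂[k] _i : Fin n, Λ)

/-- The multilinear map `(λ₀, …, λₙ) ↦ (b ↦ b λ₀ ⊗ λ₁ ⊗ ⋯ ⊗ λₙ)`. -/
noncomputable def hochschildFirstMultilinear (n : ℕ) :
    MultilinearMap k (fun _i : Fin (n + 1) => Λ) (B →ₗ[k] HochschildChain k Λ B n) where
  toFun f := ((TensorProduct.mk k B (⨂[k] _i : Fin n, Λ)).flip
    (PiTensorProduct.tprod k (Fin.tail f))).comp
      (Algebra.lsmul k k B (MulOpposite.op (f 0)))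
  map_update_add' := by
    intro inst f i x y
    obtain rfl := Subsingleton.elim inst (instDecidableEqFin _)
    ext b
    induction i using Fin.cases with
    | zero => simp [Fin.tail_update_zero]
    | succ i =>
      have h (v : Λ) : Fin.tail (α := fun _ => Λ) (Function.update f i.succ v)
        = Function.update (Fin.tail (α := fun _ => Λ) f) i v := Fin.tail_update_succ f i v
      simp [h, (Fin.succ_ne_zero i).symm]
  map_update_smul' := by
    intro inst f i c x
    obtain rfl := Subsingleton.elim inst (instDecidableEqFin _)
    ext b
    induction i using Fin.cases with
    | zero => simp [Fin.tail_update_zero, TensorProduct.smul_tmul']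
    | succ i =>
      have h (v : Λ) : Fin.tail (α := fun _ => Λ) (Function.update f i.succ v)
        = Function.update (Fin.tail (α := fun _ => Λ) f) i v := Fin.tail_update_succ f i v
      simp [h, (Fin.succ_ne_zero i).symm]

/-- The multilinear map `(λ₀, …, λₙ) ↦ (b ↦ λₙ b ⊗ λ₀ ⊗ ⋯ ⊗ λₙ₋₁)`. -/
noncomputable def hochschildLastMultilinear (n : ℕ) :
    MultilinearMap k (fun _i : Fin (n + 1) => Λ) (B →ₗ[k] HochschildChain k Λ B n) where
  toFun f := ((TensorProduct.mk k B (⨂[k] _i : Fin n, Λ)).flip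
    (PiTensorProduct.tprod k (Fin.init f))).comp
      (Algebra.lsmul k k B (f (Fin.last n)))
  map_update_add' := by
    intro inst f i x y
    obtain rfl := Subsingleton.elim inst (instDecidableEqFin _)
    ext b
    induction i using Fin.lastCases with
    | last => simp [Fin.init_update_last]
    | cast i =>
      have h (v : Λ) : Fin.init (α := fun _ => Λ) (Function.update f i.castSucc v)
        = Function.update (Fin.init (α := fun _ => Λ) f) i v := Fin.init_update_castSucc f i v
      simp [h, (Fin.castSucc_ne_last i).symm]
  map_update_smul' := by
    intro inst f i c x
    obtain rfl := Subsingleton.elim inst (instDecidableEqFin _)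
    ext b
    induction i using Fin.lastCases with
    | last => simp [Fin.init_update_last, TensorProduct.smul_tmul']
    | cast i =>
      have h (v : Λ) : Fin.init (α := fun _ => Λ) (Function.update f i.castSucc v)
        = Function.update (Fin.init (α := fun _ => Λ) f) i v := Fin.init_update_castSucc f i v
      simp [h, (Fin.castSucc_ne_last i).symm]

/-- The multilinear map `(λ₀, …, λₙ) ↦ λ₀ ⊗ ⋯ ⊗ λⱼ λⱼ₊₁ ⊗ ⋯ ⊗ λₙ`. -/
noncomputable def hochschildInnerMultilinear (n : ℕ) (j : Fin n) :
    MultilinearMap k (fun _i : Fin (n + 1) => Λ) (⨂[k] _i : Fin n, Λ) where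
  toFun f := PiTensorProduct.tprod k (Fin.contractNth j.castSucc (· * ·) f)
  map_update_add' := by
    intro inst f i x y
    obtain rfl := Subsingleton.elim inst (instDecidableEqFin _)
    simp only [contractNth_castSucc_update]
    split_ifs <;> simp only [add_mul, mul_add, MultilinearMap.map_update_add]
  map_update_smul' := by
    intro inst f i c x
    obtain rfl := Subsingleton.elim inst (instDecidableEqFin _)
    simp only [contractNth_castSucc_update]
    split_ifs <;> simp only [smul_mul_assoc, mul_smul_comm, MultilinearMap.map_update_smul]

/-- The differential of the Hochschild homology complex, from degree `n + 1` to degree `n`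
(see `hochschildD_tmul` for the formula). -/
noncomputable def hochschildD (n : ℕ) :
    HochschildChain k Λ B (n + 1) →ₗ[k] HochschildChain k Λ B n :=
  TensorProduct.lift (PiTensorProduct.lift (hochschildFirstMultilinear k Λ B n)).flip
  + ∑ j : Fin n, (-1 : k) ^ ((j : ℕ) + 1) •
      LinearMap.lTensor B (PiTensorProduct.lift (hochschildInnerMultilinear k Λ n j))
  + (-1 : k) ^ (n + 1) •
      TensorProduct.lift (PiTensorProduct.lift (hochschildLastMultilinear k Λ B n)).flip

theorem hochschildD_tmul (n : ℕ) (b : B) (f : Fin (n + 1) → Λ) :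
    hochschildD k Λ B n (b ⊗ₜ[k] PiTensorProduct.tprod k f) =
      (MulOpposite.op (f 0) • b) ⊗ₜ[k] PiTensorProduct.tprod k (Fin.tail f)
      + ∑ j : Fin n, (-1 : k) ^ ((j : ℕ) + 1) •
          b ⊗ₜ[k] PiTensorProduct.tprod k (Fin.contractNth j.castSucc (· * ·) f)
      + (-1 : k) ^ (n + 1) •
          (f (Fin.last n) • b) ⊗ₜ[k] PiTensorProduct.tprod k (Fin.init f) := by
  simp [hochschildD, hochschildFirstMultilinear, hochschildInnerMultilinear,
    hochschildLastMultilinear, LinearMap.sum_apply]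

/-- The cycles of the Hochschild homology complex; everything in degree `0`. -/
noncomputable def hochschildCycles : (n : ℕ) → Submodule k (HochschildChain k Λ B n)
  | 0 => ⊤
  | n + 1 => LinearMap.ker (hochschildD k Λ B n)

/-- The boundaries of the Hochschild homology complex. -/
noncomputable def hochschildBoundaries (n : ℕ) : Submodule k (HochschildChain k Λ B n) :=
  LinearMap.range (hochschildD k Λ B n)

/-- The Hochschild homology `HH_n(Λ, B)`: cycles modulo boundaries. -/
abbrev HochschildHomology (n : ℕ) : Type _ :=
  hochschildCycles k Λ B n ⧸
    (hochschildBoundaries k Λ B n).submoduleOf (hochschildCycles k Λ B n)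

end Hochschild

/-! ### Twisted bimodules -/

section Twist

variable {k Λ : Type*} [CommRing k] [Ring Λ] [Algebra k Λ]

/-- The bimodule `B` with the left action twisted by `f` and the right action twisted by `g`:
the actions are `(λ, b) ↦ f(λ) b` and `(b, λ) ↦ b g(λ)`. -/
def TwistedBimodule (_f _g : Λ ≃ₐ[k] Λ) (B : Type*) : Type _ := B

variable (f g : Λ ≃ₐ[k] Λ) (B : Type*) [AddCommGroup B] [Module k B] [Module Λ B] [Module Λᵐᵒᵖ B]

instance : AddCommGroup (TwistedBimodule f g B) := inferInstanceAs (AddCommGroup B)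

instance : Module k (TwistedBimodule f g B) := inferInstanceAs (Module k B)

instance : Module Λ (TwistedBimodule f g B) :=
  Module.compHom B (f : Λ →+* Λ)

instance : Module Λᵐᵒᵖ (TwistedBimodule f g B) :=
  Module.compHom B (RingHom.op (g : Λ →+* Λ))

instance [IsScalarTower k Λ B] : IsScalarTower k Λ (TwistedBimodule f g B) where
  smul_assoc c l b := by
    change (f (c • l) • (show B from b) : B) = c • (f l • (show B from b) : B)
    rw [map_smul, smul_assoc]

instance [IsScalarTower k Λᵐᵒᵖ B] : IsScalarTower k Λᵐᵒᵖ (TwistedBimodule f g B) where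
  smul_assoc c l b := by
    change (MulOpposite.op (g (c • l.unop)) • (show B from b) : B) =
      c • (MulOpposite.op (g l.unop) • (show B from b) : B)
    rw [map_smul, MulOpposite.op_smul, smul_assoc]

instance [SMulCommClass Λ Λᵐᵒᵖ B] : SMulCommClass Λ Λᵐᵒᵖ (TwistedBimodule f g B) where
  smul_comm l r b := by
    change (f l • MulOpposite.op (g r.unop) • (show B from b) : B) =
      MulOpposite.op (g r.unop) • f l • (show B from b)
    rw [smul_comm]

end Twist

/-! ### Frobenius algebras and Nakayama automorphisms -/

section Frobenius

variable (k Λ : Type*) [Field k] [Ring Λ] [Algebra k Λ]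

/-- An isomorphism `φ : Λ → D(Λ) = Hom_k(Λ, k)` of left `Λ`-modules, where `Λ` acts on `D(Λ)` by
`(x · h)(y) = h(y x)`. (Its existence forces `Λ` to be finite dimensional over `k`; a finite
dimensional algebra which admits one is a Frobenius algebra.) -/
structure FrobeniusIso extends Λ ≃ₗ[k] Module.Dual k Λ where
  map_mul' : ∀ x l y : Λ, toFun (x * l) y = toFun l (y * x)

variable {k Λ}

/-- `ν` is the Nakayama automorphism with respect to `φ`: `φ(1)(l x) = φ(1)(ν(x) l)` for all
`l, x ∈ Λ`. -/
def FrobeniusIso.IsNakayama (φ : FrobeniusIso k Λ) (ν : Λ ≃ₐ[k] Λ) : Prop :=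
  ∀ l x : Λ, φ.toLinearEquiv 1 (l * x) = φ.toLinearEquiv 1 (ν x * l)

end Frobenius

/-! ### Quantum complete intersections of codimension two -/

section QuantumCompleteIntersection

variable {k : Type*} [Field k]

/-- The relations `X ^ a = 0`, `X Y = q Y X`, `Y ^ b = 0` in the free algebra `k⟨X, Y⟩`, where
`X` and `Y` are the generators with index `0` and `1`. -/
inductive QuantumRel (q : k) (a b : ℕ) :
    FreeAlgebra k (Fin 2) → FreeAlgebra k (Fin 2) → Prop
  | pow_X : QuantumRel q a b (FreeAlgebra.ι k 0 ^ a) 0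
  | comm : QuantumRel q a b (FreeAlgebra.ι k 0 * FreeAlgebra.ι k 1)
      (q • (FreeAlgebra.ι k 1 * FreeAlgebra.ι k 0))
  | pow_Y : QuantumRel q a b (FreeAlgebra.ι k 1 ^ b) 0

/-- The algebra `k⟨X, Y⟩ / (X ^ a, X Y - q Y X, Y ^ b)`. -/
abbrev QuantumCI (q : k) (a b : ℕ) : Type _ := RingQuot (QuantumRel q a b)

end QuantumCompleteIntersection

/-! Let `E = A ⊗ A` be the free bimodule; its Hochschild complex is acyclic in positive degrees, and
`HH_0(E) = A` via `u ⊗ v ↦ v u`. The plan is to present the twisted bimodule as a quotient of `E` by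
two relations and to carry acyclicity from `E` to that quotient, one relation at a time.

Presentation. The coefficient of `yᵇ⁻¹ xᵃ⁻¹` is a Frobenius form whose Nakayama automorphism is
inverse to `σ : x ↦ qᵇ⁻¹ x, y ↦ q⁻⁽ᵃ⁻¹⁾ y`. Any other Frobenius form is the translate of this one by
a unit `w`, so `ν⁻¹` is conjugate to `σ` by `w`. Therefore `u ⊗ v ↦ w σ(u) v` identifies the twisted
bimodule with `E` modulo the images of `X_s = x ⊗ 1 - qˢ 1 ⊗ x` and `Y_c = y ⊗ 1 - c 1 ⊗ y` (acting
in the two inner places), where `s = b - 1` and `c = q⁻⁽ᵃ⁻¹⁾`.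

Transfer. `X_s` alternates with its norm operator in an exact two-periodic sequence of copies of
`E`. Modulo `x`, the operator `Y_c` alternates with its norm in the same way, except that passing
`y` across `x` changes the parameter: the maps are `E/X_{s+1} → E/X_s` and `E/X_{s+b-1} → E/X_s`. By
dimension shifting (`acyclic_coker_of_periodic`, `FreeBimodule.acyclic_of_periodic`) the cokernel is
again acyclic in positive degrees as soon as the sequence remains exact on `HH_0`.

Exactness on `HH_0`. On `A`, the operators of the `x` stage send `yⁱ xʲ` to a multiple of another
monomial, with scalars `1 - qˢ⁺ⁱ` and the geometric sum of `qˢ⁺ⁱ`. These are nonzero because `s ≥ 1`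
and `q` is not a root of unity. Only the classes of the `yⁱ` survive in `HH_0(E/X_s)`, and on them
the scalars of the `y` stage are `1 - c` and the geometric sum of `c`, nonzero since `c ≠ 1` and `cᵇ
≠ 1`. -/

section HochschildFunctoriality

/-! ### Hochschild chains: reduction to pure tensors and functoriality in the coefficients. -/

theorem HochschildChain.induction {k Λ B : Type*} [CommRing k] [Ring Λ] [Algebra k Λ]
    [AddCommGroup B] [Module k B] {n : ℕ} {p : HochschildChain k Λ B n → Prop}
    (z : HochschildChain k Λ B n) (hadd : ∀ x y, p x → p y → p (x + y))
    (htmul : ∀ (b : B) (f : Fin n → Λ), p (b ⊗ₜ[k] PiTensorProduct.tprod k f)) : p z := by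
  induction z using TensorProduct.induction_on with
  | zero => simpa using htmul 0 0
  | add x y hx hy => exact hadd x y hx hy
  | tmul b t =>
    induction t using PiTensorProduct.induction_on generalizing b with
    | smul_tprod r f => rw [TensorProduct.tmul_smul, TensorProduct.smul_tmul']; exact htmul _ f
    | add x y hx hy => rw [TensorProduct.tmul_add]; exact hadd _ _ (hx b) (hy b)

variable {k Λ B B' : Type*} [CommRing k] [Ring Λ] [Algebra k Λ]
  [AddCommGroup B] [Module k B] [Module Λ B] [Module Λᵐᵒᵖ B]
  [IsScalarTower k Λ B] [IsScalarTower k Λᵐᵒᵖ B]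
  [AddCommGroup B'] [Module k B'] [Module Λ B'] [Module Λᵐᵒᵖ B']
  [IsScalarTower k Λ B'] [IsScalarTower k Λᵐᵒᵖ B']

variable (Λ) in
/-- The map of Hochschild chains induced by a linear map of coefficients. -/
noncomputable abbrev hochschildMap (f : B →ₗ[k] B') (n : ℕ) :
    HochschildChain k Λ B n →ₗ[k] HochschildChain k Λ B' n :=
  LinearMap.rTensor _ f

theorem hochschildD_map (f : B →ₗ[k] B') (hl : ∀ (l : Λ) (b : B), f (l • b) = l • f b)
    (hr : ∀ (r : Λᵐᵒᵖ) (b : B), f (r • b) = r • f b) (n : ℕ)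
    (z : HochschildChain k Λ B (n + 1)) :
    hochschildD k Λ B' n (hochschildMap Λ f (n + 1) z) =
      hochschildMap Λ f n (hochschildD k Λ B n z) := by
  induction z using HochschildChain.induction with
  | hadd x y hx hy => simp only [map_add, hx, hy]
  | htmul b t => simp [hochschildD_tmul, hl, hr]

end HochschildFunctoriality

/-! ### The free bimodule of rank one and its Hochschild complex. -/

section FreeBimodule

variable (k Λ : Type*) [CommRing k] [Ring Λ] [Algebra k Λ]

/-- The free bimodule `Λ ⊗ Λ` of rank one, with `l • (u ⊗ v) • r = l u ⊗ v r`. -/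
def FreeBimodule : Type _ := Λ ⊗[k] Λ

namespace FreeBimodule

noncomputable instance : AddCommGroup (FreeBimodule k Λ) := inferInstanceAs (AddCommGroup (Λ ⊗[k] Λ))

noncomputable instance : Module k (FreeBimodule k Λ) := inferInstanceAs (Module k (Λ ⊗[k] Λ))

noncomputable instance : Module Λ (FreeBimodule k Λ) := inferInstanceAs (Module Λ (Λ ⊗[k] Λ))

instance : IsScalarTower k Λ (FreeBimodule k Λ) :=
  inferInstanceAs (IsScalarTower k Λ (Λ ⊗[k] Λ))

/-- The right action on the free bimodule, as a ring homomorphism to endomorphisms. -/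
noncomputable def rightAction : Λᵐᵒᵖ →+* Module.End k (Λ ⊗[k] Λ) where
  toFun r := LinearMap.lTensor Λ (LinearMap.mulRight k r.unop)
  map_one' := by ext; simp
  map_mul' r s := by ext; simp [mul_assoc]
  map_zero' := by ext; simp
  map_add' r s := by ext; simp [mul_add, TensorProduct.tmul_add]

noncomputable instance : Module Λᵐᵒᵖ (FreeBimodule k Λ) :=
  Module.compHom (Λ ⊗[k] Λ) (rightAction k Λ)

variable {k Λ}

/-- The pure tensors of the free bimodule. -/
noncomputable def tmul (u v : Λ) : FreeBimodule k Λ := u ⊗ₜ[k] v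

theorem smul_tmul (l u v : Λ) : l • (tmul u v : FreeBimodule k Λ) = tmul (l * u) v := rfl

theorem op_smul_tmul (r u v : Λ) :
    MulOpposite.op r • (tmul u v : FreeBimodule k Λ) = tmul u (v * r) := by
  change rightAction k Λ (MulOpposite.op r) (u ⊗ₜ[k] v) = _
  simp [rightAction, tmul]

theorem induction {p : FreeBimodule k Λ → Prop} (z : FreeBimodule k Λ)
    (hadd : ∀ x y, p x → p y → p (x + y)) (htmul : ∀ u v, p (tmul u v)) : p z := by
  induction z using TensorProduct.induction_on with
  | zero => simpa [tmul] using htmul 0 0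
  | add x y hx hy => exact hadd x y hx hy
  | tmul u v => exact htmul u v

instance : IsScalarTower k Λᵐᵒᵖ (FreeBimodule k Λ) where
  smul_assoc c r z := by
    change rightAction k Λ (c • r) z = c • (rightAction k Λ r z)
    have : rightAction k Λ (c • r) = c • rightAction k Λ r := by ext; simp [rightAction]
    rw [this]; rfl

/-- Linear maps out of the free bimodule from bilinear maps. -/
noncomputable def lift {M : Type*} [AddCommGroup M] [Module k M] (f : Λ →ₗ[k] Λ →ₗ[k] M) :
    FreeBimodule k Λ →ₗ[k] M := TensorProduct.lift f

@[simp] theorem lift_tmul {M : Type*} [AddCommGroup M] [Module k M] (f : Λ →ₗ[k] Λ →ₗ[k] M)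
    (u v : Λ) : lift f (tmul u v) = f u v := TensorProduct.lift.tmul u v

/-- The canonical bilinear map to the free bimodule. -/
noncomputable def mk : Λ →ₗ[k] Λ →ₗ[k] FreeBimodule k Λ := TensorProduct.mk k Λ Λ

@[simp] theorem mk_apply (u v : Λ) : mk (k := k) u v = tmul u v := rfl

/-- The endomorphism `u ⊗ v ↦ f u ⊗ g v` of the free bimodule. -/
noncomputable def map (f g : Λ →ₗ[k] Λ) : Module.End k (FreeBimodule k Λ) := TensorProduct.map f g

@[simp] theorem map_tmul (f g : Λ →ₗ[k] Λ) (u v : Λ) :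
    map f g (tmul u v) = tmul (f u) (g v) := TensorProduct.map_tmul f g u v

theorem hom_ext {M : Type*} [AddCommGroup M] [Module k M] {f g : FreeBimodule k Λ →ₗ[k] M}
    (h : ∀ u v, f (tmul u v) = g (tmul u v)) : f = g :=
  TensorProduct.ext' h

/-- Multiplication on the left factor from the right, `u ⊗ v ↦ u r ⊗ v`. -/
noncomputable abbrev innerL (r : Λ) : Module.End k (FreeBimodule k Λ) :=
  map (LinearMap.mulRight k r) LinearMap.id

/-- Multiplication on the right factor from the left, `u ⊗ v ↦ u ⊗ l v`. -/
noncomputable abbrev innerR (l : Λ) : Module.End k (FreeBimodule k Λ) :=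
  map LinearMap.id (LinearMap.mulLeft k l)

variable (k Λ) in
/-- The subalgebra of endomorphisms of the free bimodule which commute with both actions. -/
def bimoduleEnd : Subalgebra k (Module.End k (FreeBimodule k Λ)) where
  carrier := {f | (∀ (l : Λ) z, f (l • z) = l • f z) ∧ ∀ (r : Λᵐᵒᵖ) z, f (r • z) = r • f z}
  mul_mem' := by
    rintro f g ⟨h1, h2⟩ ⟨h3, h4⟩
    exact ⟨fun l z => by simp [h1, h3], fun l z => by simp [h2, h4]⟩
  add_mem' := by
    rintro f g ⟨h1, h2⟩ ⟨h3, h4⟩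
    exact ⟨fun l z => by simp [h1, h3], fun l z => by simp [h2, h4]⟩
  algebraMap_mem' c := by
    refine ⟨fun l z => ?_, fun r z => ?_⟩
    · simp only [Module.algebraMap_end_apply]
      rw [← algebraMap_smul Λ c z, ← algebraMap_smul Λ c (l • z), smul_smul, smul_smul,
        Algebra.commutes]
    · simp only [Module.algebraMap_end_apply]
      rw [← algebraMap_smul Λᵐᵒᵖ c z, ← algebraMap_smul Λᵐᵒᵖ c (r • z), smul_smul, smul_smul,
        Algebra.commutes]

theorem innerL_mem (r : Λ) : innerL r ∈ bimoduleEnd k Λ := by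
  refine ⟨fun l z => ?_, fun s z => ?_⟩
  · induction z using induction with
    | hadd x y hx hy => simp only [smul_add, map_add, hx, hy]
    | htmul u v => simp [smul_tmul, mul_assoc]
  · induction s using MulOpposite.rec'
    induction z using induction with
    | hadd x y hx hy => simp only [smul_add, map_add, hx, hy]
    | htmul u v => simp [op_smul_tmul]

theorem innerR_mem (r : Λ) : innerR r ∈ bimoduleEnd k Λ := by
  refine ⟨fun l z => ?_, fun s z => ?_⟩
  · induction z using induction with
    | hadd x y hx hy => simp only [smul_add, map_add, hx, hy]
    | htmul u v => simp [smul_tmul]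
  · induction s using MulOpposite.rec'
    induction z using induction with
    | hadd x y hx hy => simp only [smul_add, map_add, hx, hy]
    | htmul u v => simp [op_smul_tmul, mul_assoc]

theorem hochschildD_map {f : Module.End k (FreeBimodule k Λ)} (hf : f ∈ bimoduleEnd k Λ) (n : ℕ)
    (z : HochschildChain k Λ (FreeBimodule k Λ) (n + 1)) :
    hochschildD k Λ (FreeBimodule k Λ) n (hochschildMap Λ f (n + 1) z) =
      hochschildMap Λ f n (hochschildD k Λ (FreeBimodule k Λ) n z) :=
  _root_.hochschildD_map f hf.1 hf.2 n z

/-! #### The contraction of the Hochschild complex of the free bimodule -/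

variable (k Λ) in
/-- The linear map `v ⊗ (λ₁ ⊗ ⋯ ⊗ λₙ) ↦ v ⊗ λ₁ ⊗ ⋯ ⊗ λₙ`, curried. -/
noncomputable def consTensor (n : ℕ) :
    Λ →ₗ[k] (⨂[k] _i : Fin n, Λ) →ₗ[k] ⨂[k] _i : Fin (n + 1), Λ :=
  (PiTensorProduct.lift (R := k) (s := fun _ : Fin n => Λ)).toLinearMap ∘ₗ
    (PiTensorProduct.tprod k (s := fun _ : Fin (n + 1) => Λ)).curryLeft

@[simp] theorem consTensor_tprod (n : ℕ) (v : Λ) (t : Fin n → Λ) :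
    consTensor k Λ n v (PiTensorProduct.tprod k t) =
      PiTensorProduct.tprod k (Fin.cons v t : Fin (n + 1) → Λ) := by
  simp [consTensor]

variable (k Λ) in
/-- The contraction `(u ⊗ v) ⊗ λ₁ ⊗ ⋯ ⊗ λₙ ↦ (u ⊗ 1) ⊗ v ⊗ λ₁ ⊗ ⋯ ⊗ λₙ`. -/
noncomputable def contraction (n : ℕ) :
    HochschildChain k Λ (FreeBimodule k Λ) n →ₗ[k]
      HochschildChain k Λ (FreeBimodule k Λ) (n + 1) :=
  TensorProduct.lift <| lift <| LinearMap.mk₂ k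
    (fun u v => TensorProduct.mk k (FreeBimodule k Λ) _ (mk u 1) ∘ₗ consTensor k Λ n v)
    (fun u u' v => by ext; simp)
    (fun c u v => by ext; simp [TensorProduct.smul_tmul'])
    (fun u v v' => by ext; simp [-consTensor_tprod, TensorProduct.tmul_add])
    (fun c u v => by ext; simp [-consTensor_tprod])

@[simp] theorem contraction_tmul (n : ℕ) (u v : Λ) (t : Fin n → Λ) :
    contraction k Λ n (tmul u v ⊗ₜ[k] PiTensorProduct.tprod k t) =
      tmul u 1 ⊗ₜ[k] PiTensorProduct.tprod k (Fin.cons v t : Fin (n + 1) → Λ) := by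
  simp [contraction]

variable (k Λ) in
/-- The augmentation `u ⊗ v ↦ v u` of the Hochschild complex of the free bimodule. -/
noncomputable def augmentation : HochschildChain k Λ (FreeBimodule k Λ) 0 →ₗ[k] Λ :=
  lift (LinearMap.mul k Λ).flip ∘ₗ (TensorProduct.rid k _).toLinearMap ∘ₗ
    LinearMap.lTensor _ (PiTensorProduct.isEmptyEquiv (Fin 0)).toLinearMap

@[simp] theorem augmentation_tmul (u v : Λ) (t : Fin 0 → Λ) :
    augmentation k Λ (tmul u v ⊗ₜ[k] PiTensorProduct.tprod k t) = v * u := by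
  simp [augmentation]

theorem chain_induction {n : ℕ} {p : HochschildChain k Λ (FreeBimodule k Λ) n → Prop}
    (z : HochschildChain k Λ (FreeBimodule k Λ) n) (hadd : ∀ x y, p x → p y → p (x + y))
    (htmul : ∀ (u v : Λ) (f : Fin n → Λ), p (tmul u v ⊗ₜ[k] PiTensorProduct.tprod k f)) : p z := by
  induction z using HochschildChain.induction with
  | hadd x y hx hy => exact hadd x y hx hy
  | htmul b t =>
    induction b using induction with
    | hadd x y hx hy => rw [TensorProduct.add_tmul]; exact hadd _ _ hx hy
    | htmul u v => exact htmul u v t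

theorem contractNth_zero_cons {n : ℕ} (v : Λ) (t : Fin (n + 1) → Λ) :
    Fin.contractNth (0 : Fin (n + 2)) (· * ·) (Fin.cons v t : Fin (n + 2) → Λ) =
      (Fin.cons (v * t 0) (Fin.tail t) : Fin (n + 1) → Λ) := by
  funext i
  induction i using Fin.cases with
  | zero => simp [Fin.contractNth]
  | succ i => simp [Fin.contractNth, Fin.tail]

theorem contractNth_succ_cons {n : ℕ} (j : Fin (n + 1)) (v : Λ) (t : Fin (n + 1) → Λ) :
    Fin.contractNth j.succ (· * ·) (Fin.cons v t : Fin (n + 2) → Λ) =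
      (Fin.cons v (Fin.contractNth j (· * ·) t) : Fin (n + 1) → Λ) := by
  funext i
  induction i using Fin.cases with
  | zero => simp [Fin.contractNth]
  | succ i => simp [Fin.contractNth]

/-- The first face of the contracted chain multiplies the inserted `1` by `v` and gives back `z`.
Every later face is a face of `z` with `v` put in front and the sign reversed. -/
theorem hochschildD_contraction (n : ℕ) (z : HochschildChain k Λ (FreeBimodule k Λ) (n + 1)) :
    hochschildD k Λ _ (n + 1) (contraction k Λ (n + 1) z) =
      z - contraction k Λ n (hochschildD k Λ _ n z) := by
  induction z using chain_induction with
  | hadd x y hx hy => simp only [map_add, hx, hy]; abel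
  | htmul u v t =>
    have h0 := contractNth_zero_cons v t
    have hl : (Fin.cons v t : Fin (n + 2) → Λ) (Fin.last (n + 1)) = t (Fin.last n) := by
      rw [← Fin.succ_last, Fin.cons_succ]
    have hi : Fin.init (α := fun _ => Λ) (Fin.cons v t : Fin (n + 2) → Λ) =
        (Fin.cons v (Fin.init (α := fun _ => Λ) t) : Fin (n + 1) → Λ) := by
      funext i
      induction i using Fin.cases with
      | zero => simp [Fin.init]
      | succ i => simp [Fin.init]
    rw [contraction_tmul, hochschildD_tmul, hochschildD_tmul, Fin.sum_univ_succ]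
    simp only [map_add, map_sum, map_smul, op_smul_tmul, smul_tmul, contraction_tmul, hl, hi,
      Fin.castSucc_zero, h0, ← Fin.succ_castSucc, contractNth_succ_cons, Fin.cons_zero,
      Fin.tail_cons, one_mul, Fin.val_zero, Fin.val_succ]
    simp only [pow_succ, mul_neg, mul_one, neg_smul, Finset.sum_neg_distrib, pow_zero, one_smul,
      neg_neg]
    abel

/-- In degree zero the last face `v · (u ⊗ 1) = v u ⊗ 1` has nothing to cancel it. The identity is
thus homotopic to the augmentation followed by its section `a ↦ a ⊗ 1`. -/
theorem hochschildD_contraction_zero (z : HochschildChain k Λ (FreeBimodule k Λ) 0) :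
    hochschildD k Λ _ 0 (contraction k Λ 0 z) =
      z - mk (augmentation k Λ z) 1 ⊗ₜ[k] PiTensorProduct.tprod k ![] := by
  induction z using chain_induction with
  | hadd x y hx hy => simp only [map_add, hx, hy, LinearMap.add_apply, TensorProduct.add_tmul]; abel
  | htmul u v t =>
    rw [contraction_tmul, hochschildD_tmul]
    have h1 : t = ![] := Subsingleton.elim _ _
    have h2 : Fin.init (α := fun _ => Λ) ![v] = ![] := Subsingleton.elim _ _
    simp [op_smul_tmul, smul_tmul, h1, h2, sub_eq_add_neg]

theorem augmentation_hochschildD (z : HochschildChain k Λ (FreeBimodule k Λ) 1) :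
    augmentation k Λ (hochschildD k Λ _ 0 z) = 0 := by
  induction z using chain_induction with
  | hadd x y hx hy => simp only [map_add, hx, hy, add_zero]
  | htmul u v t =>
    rw [hochschildD_tmul]
    simp [op_smul_tmul, smul_tmul, mul_assoc]

theorem augmentation_surjective : Function.Surjective (augmentation k Λ) := fun a =>
  ⟨tmul a 1 ⊗ₜ[k] PiTensorProduct.tprod k ![], by simp⟩

theorem mem_range_hochschildD_zero {z : HochschildChain k Λ (FreeBimodule k Λ) 0}
    (hz : augmentation k Λ z = 0) : z ∈ LinearMap.range (hochschildD k Λ _ 0) :=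
  ⟨contraction k Λ 0 z, by simp [hochschildD_contraction_zero, hz]⟩

theorem mem_range_hochschildD {n : ℕ} {z : HochschildChain k Λ (FreeBimodule k Λ) (n + 1)}
    (hz : hochschildD k Λ _ n z = 0) : z ∈ LinearMap.range (hochschildD k Λ _ (n + 1)) :=
  ⟨contraction k Λ (n + 1) z, by simp [hochschildD_contraction, hz]⟩

/-- The contraction `h` replaces the usual cancellation of faces. From `d h = 1 - h d` one gets `d d
h = d - d h d = h d d`, which vanishes by induction, and bimodule endomorphisms carry the image of
`h` to all chains. -/
theorem hochschildD_hochschildD (n : ℕ) (z : HochschildChain k Λ (FreeBimodule k Λ) (n + 2)) :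
    hochschildD k Λ _ n (hochschildD k Λ _ (n + 1) z) = 0 := by
  induction n with
  | zero =>
    induction z using chain_induction with
    | hadd x y hx hy => simp only [map_add, hx, hy, add_zero]
    | htmul u v t =>
      -- The contraction produces `u ⊗ 1` as coefficient; the endomorphism `innerR v`, which
      -- commutes with `d`, turns it into `u ⊗ v`.
      have : tmul u v ⊗ₜ[k] PiTensorProduct.tprod k t = hochschildMap Λ (innerR v) 2
          (contraction k Λ 1 (tmul u (t 0) ⊗ₜ[k] PiTensorProduct.tprod k (Fin.tail t))) := by
        simp
      rw [this, hochschildD_map (innerR_mem v), hochschildD_map (innerR_mem v),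
        hochschildD_contraction, map_sub, hochschildD_contraction_zero, augmentation_hochschildD]
      simp
  | succ n ih =>
    induction z using chain_induction with
    | hadd x y hx hy => simp only [map_add, hx, hy, add_zero]
    | htmul u v t =>
      have : tmul u v ⊗ₜ[k] PiTensorProduct.tprod k t = hochschildMap Λ (innerR v) (n + 3)
          (contraction k Λ (n + 2)
            (tmul u (t 0) ⊗ₜ[k] PiTensorProduct.tprod k (Fin.tail t))) := by
        simp
      rw [this, hochschildD_map (innerR_mem v), hochschildD_map (innerR_mem v),
        hochschildD_contraction, map_sub, hochschildD_contraction, ih]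
      simp

end FreeBimodule

end FreeBimodule

/-! ### Exactness relative to a submodule after tensoring over a field. -/

section TensorExactness

variable {k E F G G₁ G₂ : Type*} [Field k] [AddCommGroup E] [Module k E] [AddCommGroup F]
  [Module k F] [AddCommGroup G] [Module k G] [AddCommGroup G₁] [Module k G₁]
  [AddCommGroup G₂] [Module k G₂]

/-- Over a field, the condition that `h z ∈ range w` implies `z ∈ range g₁ ⊔ range g₂` is preserved
by tensoring. -/
theorem rTensor_mem_range_sup {h : E →ₗ[k] F} {w : G →ₗ[k] F} {g₁ : G₁ →ₗ[k] E} {g₂ : G₂ →ₗ[k] E}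
    (hg₁ : ∀ x, h (g₁ x) ∈ LinearMap.range w) (hg₂ : ∀ x, h (g₂ x) ∈ LinearMap.range w)
    (H : ∀ z, h z ∈ LinearMap.range w → z ∈ LinearMap.range g₁ ⊔ LinearMap.range g₂)
    (V : Type*) [AddCommGroup V] [Module k V] {z : E ⊗[k] V}
    (hz : h.rTensor V z ∈ LinearMap.range (w.rTensor V)) :
    z ∈ LinearMap.range (g₁.rTensor V) ⊔ LinearMap.range (g₂.rTensor V) := by
  -- The condition says that `G₁ × G₂ → E → F / range w` is exact in the middle, and flatness
  -- preserves this.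
  set p := (LinearMap.range w).mkQ
  have hwp : Function.Exact w p := fun y => by simp [p]
  have hex : Function.Exact (g₁.coprod g₂) (p ∘ₗ h) := fun y => by
    have : (p ∘ₗ h) y = 0 ↔ h y ∈ LinearMap.range w := by simp [p]
    rw [this]
    change _ ↔ y ∈ LinearMap.range (g₁.coprod g₂)
    rw [LinearMap.range_coprod]
    refine ⟨H y, fun hy => ?_⟩
    obtain ⟨_, ⟨x₁, rfl⟩, _, ⟨x₂, rfl⟩, rfl⟩ := Submodule.mem_sup.1 hy
    rw [map_add]
    exact add_mem (hg₁ x₁) (hg₂ x₂)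
  have hex' := Module.Flat.rTensor_exact V hex
  have hwp' : p.rTensor V ∘ₗ w.rTensor V = 0 := by
    rw [← LinearMap.rTensor_comp, hwp.linearMap_comp_eq_zero, LinearMap.rTensor_zero]
  obtain ⟨t, ht⟩ := hz
  have : (p ∘ₗ h).rTensor V z = 0 := by
    rw [LinearMap.rTensor_comp, LinearMap.comp_apply, ← ht, ← LinearMap.comp_apply, hwp']; rfl
  obtain ⟨y, rfl⟩ := (hex' z).1 this
  clear this ht
  induction y using TensorProduct.induction_on with
  | zero => simp
  | tmul x v =>
    obtain ⟨x₁, x₂⟩ := x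
    simp only [LinearMap.rTensor_tmul, LinearMap.coprod_apply, TensorProduct.add_tmul]
    exact Submodule.add_mem_sup ⟨x₁ ⊗ₜ v, by simp⟩ ⟨x₂ ⊗ₜ v, by simp⟩
  | add x y hx hy =>
    rw [map_add]
    exact add_mem hx hy

end TensorExactness

/-! ### Dimension shifting along a periodic family of quotient complexes. -/

section ComplexExactness

variable {k : Type*} [CommRing k] {C : ℕ → Type*} [∀ n, AddCommGroup (C n)] [∀ n, Module k (C n)]
  {I : Type*}

/-- Let `C` be a complex with subcomplexes `U i` such that all `C / U i` are acyclic in positive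
degrees, and let `⋯ → C / U (σ (σ i)) → C / U (σ i) → C / U i` be degreewise exact sequences of
complexes, which remain exact on homology in degree zero. Then the cokernels of
`C / U (σ i) → C / U i` are acyclic in positive degrees. -/
theorem acyclic_coker_of_periodic (d : ∀ n, C (n + 1) →ₗ[k] C n)
    (hdd : ∀ n z, d n (d (n + 1) z) = 0) (σ : I → I) (f : I → ∀ n, C n →ₗ[k] C n)
    (U : I → ∀ n, Submodule k (C n))
    (hfd : ∀ i n z, d n (f i (n + 1) z) = f i n (d n z))
    (hUd : ∀ i n z, z ∈ U i (n + 1) → d n z ∈ U i n)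
    (hfU : ∀ i n z, z ∈ U (σ i) n → f i n z ∈ U i n)
    (hff : ∀ i n z, f i n (f (σ i) n z) ∈ U i n)
    (hfe : ∀ i n z, f i n z ∈ U i n → z ∈ LinearMap.range (f (σ i) n) ⊔ U (σ i) n)
    (hH : ∀ i z, f i 0 z ∈ U i 0 ⊔ LinearMap.range (d 0) →
      z ∈ LinearMap.range (f (σ i) 0) ⊔ U (σ i) 0 ⊔ LinearMap.range (d 0))
    (hex : ∀ i n z, d n z ∈ U i n → z ∈ U i (n + 1) ⊔ LinearMap.range (d (n + 1)))
    (n : ℕ) : ∀ i z, d n z ∈ LinearMap.range (f i n) ⊔ U i n →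
      z ∈ LinearMap.range (f i (n + 1)) ⊔ U i (n + 1) ⊔ LinearMap.range (d (n + 1)) := by
  have key (n : ℕ) (i : I) (z : C (n + 1)) (w u : C n) (hu : u ∈ U i n) (hz : f i n w + u = d n z)
      (hw : w ∈ LinearMap.range (f (σ i) n) ⊔ U (σ i) n ⊔ LinearMap.range (d n)) :
      z ∈ LinearMap.range (f i (n + 1)) ⊔ U i (n + 1) ⊔ LinearMap.range (d (n + 1)) := by
    obtain ⟨_, hw', _, ⟨w₁, rfl⟩, rfl⟩ := Submodule.mem_sup.1 hw
    obtain ⟨_, ⟨w₂, rfl⟩, u', hu', rfl⟩ := Submodule.mem_sup.1 hw'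
    -- Writing `w = f w₂ + u' + d w₁`, the map `f i` sends the first two summands into `U i`. So `z`
    -- corrected by `f i w₁` is a cycle modulo `U i`, to which `hex` applies.
    have : d n (z - f i (n + 1) w₁) ∈ U i n := by
      rw [map_sub, hfd, ← hz]
      simp only [map_add]
      convert add_mem (add_mem (hff i n w₂) (hfU i n u' hu')) hu using 1
      abel
    have h2 := hex i n _ this
    rw [sup_assoc, ← add_sub_cancel (f i (n + 1) w₁) z]
    exact Submodule.add_mem_sup ⟨w₁, rfl⟩ h2
  induction n with
  | zero =>
    intro i z hz
    obtain ⟨_, ⟨w, rfl⟩, u, hu, h⟩ := Submodule.mem_sup.1 hz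
    refine key 0 i z w u hu h (hH i w ?_)
    rw [show f i 0 w = -u + d 0 z by rw [← h]; abel]
    exact Submodule.add_mem_sup (neg_mem hu) ⟨z, rfl⟩
  | succ n ih =>
    intro i z hz
    obtain ⟨_, ⟨w, rfl⟩, u, hu, h⟩ := Submodule.mem_sup.1 hz
    -- Since `f i (d w) = d (d z - u) = -d u` lies in `U i`, exactness makes `w` a cycle in the
    -- cokernel belonging to `σ i`, one degree lower.
    refine key (n + 1) i z w u hu h (ih (σ i) w (hfe i n _ ?_))
    rw [← hfd, show f i (n + 1) w = d (n + 1) z - u by rw [← h]; abel, map_sub, hdd, zero_sub]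
    exact neg_mem (hUd i n u hu)

end ComplexExactness

/-! ### Exactness of the two-periodic sequence formed by `P - c T` and its norm. -/

section TruncatedShift

/-- The sum `∑ Pⁱ (c T)ʲ` over all `i + j = n - 1`. -/
noncomputable def geomOp {k R : Type*} [CommRing k] [Ring R] [Algebra k R] (P T : R) (c : k)
    (n : ℕ) : R := ∑ i ∈ Finset.range n, P ^ i * (c • T) ^ (n - 1 - i)

theorem sub_mul_geomOp {k R : Type*} [CommRing k] [Ring R] [Algebra k R] {P T : R}
    (h : Commute P T) (c : k) (n : ℕ) : (P - c • T) * geomOp P T c n = P ^ n - (c • T) ^ n :=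
  (h.smul_right c).mul_geom_sum₂ n

theorem geomOp_mul_sub {k R : Type*} [CommRing k] [Ring R] [Algebra k R] {P T : R}
    (h : Commute P T) (c : k) (n : ℕ) : geomOp P T c n * (P - c • T) = P ^ n - (c • T) ^ n :=
  (h.smul_right c).geom_sum₂_mul n

variable (k : Type*) [Field k] {M M₀ : Type*} [AddCommGroup M] [Module k M]
  [AddCommGroup M₀] [Module k M₀]

/-- A decomposition `M = M₀ ⊕ T M₀ ⊕ ⋯ ⊕ Tⁿ⁻¹ M₀` with `Tⁿ = 0`, together with an operator `P`
which commutes with `T`, preserves `M₀` and satisfies `Pⁿ = 0`. -/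
structure TruncatedShift (n : ℕ) (P T : Module.End k M) (P₀ : Module.End k M₀) where
  ι : M₀ →ₗ[k] M
  κ : ℕ → M →ₗ[k] M₀
  comm : Commute P T
  P_pow : P ^ n = 0
  T_pow : T ^ n = 0
  P₀_pow : P₀ ^ n = 0
  κ_P : ∀ l m, κ l (P m) = P₀ (κ l m)
  ι_P : ∀ m, P (ι m) = ι (P₀ m)
  κ_T_zero : ∀ m, κ 0 (T m) = 0
  κ_T_succ : ∀ l m, l + 1 < n → κ (l + 1) (T m) = κ l m
  κ_ι_zero : ∀ m, κ 0 (ι m) = m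
  κ_ι_succ : ∀ l m, κ (l + 1) (ι m) = 0
  sum_eq : ∀ m, ∑ l ∈ Finset.range n, (T ^ l) (ι (κ l m)) = m

namespace TruncatedShift

variable {k} {n : ℕ} {P T : Module.End k M} {P₀ : Module.End k M₀}
  (S : TruncatedShift k n P T P₀)

theorem κ_P_pow (l i : ℕ) (m : M) : S.κ l ((P ^ i) m) = (P₀ ^ i) (S.κ l m) := by
  induction i with
  | zero => simp
  | succ i ih => rw [pow_succ', pow_succ', Module.End.mul_apply, S.κ_P, ih, Module.End.mul_apply]

theorem ι_P_pow (i : ℕ) (m : M₀) : (P ^ i) (S.ι m) = S.ι ((P₀ ^ i) m) := by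
  induction i with
  | zero => simp
  | succ i ih => rw [pow_succ', pow_succ', Module.End.mul_apply, ih, S.ι_P, Module.End.mul_apply]

theorem κ_T_pow (l s : ℕ) (h : l + s < n) (m : M) : S.κ (l + s) ((T ^ s) m) = S.κ l m := by
  induction s with
  | zero => simp
  | succ s ih => rw [pow_succ', Module.End.mul_apply, ← add_assoc, S.κ_T_succ _ _ (by omega),
      ih (by omega)]

theorem sub_geomOp (S : TruncatedShift k n P T P₀) (c : k) (m : M) : (P - c • T) (geomOp P T c n m) = 0 := by
  rw [← Module.End.mul_apply, sub_mul_geomOp S.comm, S.P_pow, smul_pow, S.T_pow]; simp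

theorem geomOp_sub (S : TruncatedShift k n P T P₀) (c : k) (m : M) : geomOp P T c n ((P - c • T) m) = 0 := by
  rw [← Module.End.mul_apply, geomOp_mul_sub S.comm, S.P_pow, smul_pow, S.T_pow]; simp

/-- In components, `P m = c T m` reads `κ l m = c⁻¹ P₀ (κ (l + 1) m)`, so `m` is determined by its
top component. The norm of that component, rescaled by `c⁻⁽ⁿ⁻¹⁾`, has the same components. -/
theorem mem_range_geomOp (S : TruncatedShift k n P T P₀) {c : k} (hc : c ≠ 0) {m : M} (hm : (P - c • T) m = 0) :
    m ∈ LinearMap.range (geomOp P T c n) := by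
  have h1 (l : ℕ) (hl : l + 1 < n) : S.κ l m = c⁻¹ • P₀ (S.κ (l + 1) m) := by
    have : P m = c • T m := by simpa [sub_eq_zero] using hm
    rw [← S.κ_P, this, map_smul, S.κ_T_succ l m hl, inv_smul_smul₀ hc]
  have h2 (j : ℕ) (hj : j < n) : S.κ (n - 1 - j) m = (c⁻¹) ^ j • (P₀ ^ j) (S.κ (n - 1) m) := by
    induction j with
    | zero => simp
    | succ j ih =>
      rw [h1 _ (by omega), show n - 1 - (j + 1) + 1 = n - 1 - j by omega, ih (by omega),
        map_smul, smul_smul, pow_succ', pow_succ', Module.End.mul_apply]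
  refine ⟨(c⁻¹) ^ (n - 1) • S.ι (S.κ (n - 1) m), ?_⟩
  conv_rhs => rw [← S.sum_eq m, ← Finset.sum_range_reflect]
  simp only [geomOp, LinearMap.sum_apply]
  refine Finset.sum_congr rfl fun i hi => ?_
  have hi' := Finset.mem_range.1 hi
  rw [h2 i hi', (((S.comm.smul_right c).pow_pow i (n - 1 - i)).eq), Module.End.mul_apply, map_smul,
    S.ι_P_pow, smul_pow, LinearMap.smul_apply]
  simp only [map_smul]
  rw [smul_smul]
  congr 1
  rw [show n - 1 = (n - 1 - i) + i by omega, pow_add]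
  simp only [Nat.add_sub_cancel]
  rw [← mul_assoc, ← mul_pow, mul_inv_cancel₀ hc, one_pow, one_mul]

/-- The projection of `M` to `M₀ = M / (P - c T)`. -/
noncomputable def proj (c : k) : M →ₗ[k] M₀ :=
  ∑ l ∈ Finset.range n, (c⁻¹) ^ l • ((P₀ ^ l : Module.End k M₀) ∘ₗ S.κ l)

theorem proj_apply (c : k) (m : M) :
    S.proj c m = ∑ l ∈ Finset.range n, (c⁻¹) ^ l • (P₀ ^ l) (S.κ l m) := by
  simp [proj, LinearMap.sum_apply]

/-- Modulo the image of `P - c T` one may replace `Tˡ` by `c⁻ˡ Pˡ`, and `P` preserves `M₀`; hence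
`M₀` represents every class. -/
theorem sub_ι_proj_mem {c : k} (hc : c ≠ 0) (m : M) :
    m - S.ι (S.proj c m) ∈ LinearMap.range (P - c • T) := by
  rw [S.proj_apply, map_sum]
  nth_rw 1 [← S.sum_eq m]
  rw [← Finset.sum_sub_distrib]
  refine sum_mem fun l _ => ?_
  -- The norm of length `l`, not `n`, factors `Pˡ - (c T)ˡ` through `P - c T`.
  refine ⟨-((c⁻¹) ^ l • geomOp P T c l (S.ι (S.κ l m))), ?_⟩
  rw [map_neg, map_smul, ← Module.End.mul_apply, sub_mul_geomOp S.comm, LinearMap.sub_apply,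
    smul_pow, LinearMap.smul_apply, smul_sub, smul_smul, ← mul_pow, inv_mul_cancel₀ hc, one_pow,
    one_smul, S.ι_P_pow, map_smul, neg_sub]

/-- The two sums telescope. The end terms vanish because `κ 0 ∘ T = 0` and `P₀ⁿ = 0`. -/
theorem proj_sub {c : k} (hc : c ≠ 0) (m : M) : S.proj c ((P - c • T) m) = 0 := by
  rw [S.proj_apply]
  cases n with
  | zero => simp
  | succ n =>
    simp only [LinearMap.sub_apply, LinearMap.smul_apply, map_sub, map_smul, smul_sub,
      Finset.sum_sub_distrib, S.κ_P]
    rw [Finset.sum_range_succ, Finset.sum_range_succ' (fun l => c⁻¹ ^ l • c • _), S.κ_T_zero,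
      ← Module.End.mul_apply, ← pow_succ, S.P₀_pow]
    simp only [LinearMap.zero_apply, map_zero, smul_zero, add_zero]
    rw [sub_eq_zero]
    refine Finset.sum_congr rfl fun l hl => ?_
    rw [S.κ_T_succ _ _ (by have := Finset.mem_range.1 hl; omega), smul_smul, pow_succ c⁻¹,
      mul_assoc, inv_mul_cancel₀ hc, mul_one, ← Module.End.mul_apply, ← pow_succ]

theorem proj_eq_zero_iff {c : k} (hc : c ≠ 0) (m : M) :
    S.proj c m = 0 ↔ m ∈ LinearMap.range (P - c • T) := by
  refine ⟨fun h => by simpa [h] using S.sub_ι_proj_mem hc m, ?_⟩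
  rintro ⟨m, rfl⟩
  exact S.proj_sub hc m

theorem proj_ι (hn : 0 < n) (c : k) (m : M₀) : S.proj c (S.ι m) = m := by
  rw [S.proj_apply]
  obtain ⟨n, rfl⟩ := Nat.exists_eq_succ_of_ne_zero hn.ne'
  rw [Finset.sum_range_succ']
  simp [S.κ_ι_succ, S.κ_ι_zero]

/-- The norm kills the image of `P - c T`, so `m` may be replaced by its representative in `M₀`.
There the norm is injective: its top component is multiplication by `cⁿ⁻¹`. -/
theorem mem_range_sub (S : TruncatedShift k n P T P₀) (hn : 0 < n) {c : k} (hc : c ≠ 0) {m : M} (hm : geomOp P T c n m = 0) :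
    m ∈ LinearMap.range (P - c • T) := by
  rw [← S.proj_eq_zero_iff hc]
  obtain ⟨y, hy⟩ := S.sub_ι_proj_mem hc m
  have h1 : geomOp P T c n (S.ι (S.proj c m)) = 0 := by
    rw [← sub_sub_cancel m (S.ι _), ← hy, map_sub, hm, S.geomOp_sub, sub_zero]
  generalize S.proj c m = m' at h1
  have h2 : S.κ (n - 1) (geomOp P T c n (S.ι m')) = c ^ (n - 1) • m' := by
    obtain ⟨n, rfl⟩ := Nat.exists_eq_succ_of_ne_zero hn.ne'
    simp only [geomOp, LinearMap.sum_apply, map_sum, Nat.succ_eq_add_one, Nat.add_sub_cancel]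
    rw [Finset.sum_range_succ', Finset.sum_eq_zero]
    · simp only [pow_zero, one_mul, Nat.sub_zero, zero_add, smul_pow, LinearMap.smul_apply,
        map_smul]
      have := S.κ_T_pow 0 n (by omega) (S.ι m')
      rw [zero_add] at this
      rw [this, S.κ_ι_zero]
    · intro i hi
      have hi' := Finset.mem_range.1 hi
      rw [Module.End.mul_apply, S.κ_P_pow, smul_pow, LinearMap.smul_apply, map_smul]
      have := S.κ_T_pow (i + 1) (n - (i + 1)) (by omega) (S.ι m')
      rw [show i + 1 + (n - (i + 1)) = n by omega, S.κ_ι_succ] at this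
      rw [this, smul_zero, map_zero]
  rw [h1, map_zero] at h2
  exact (smul_eq_zero_iff_right (pow_ne_zero _ hc)).1 h2.symm

end TruncatedShift

end TruncatedShift

/-! ### Algebras with the quantum relations and a monomial basis. -/

theorem geom_sum_ne_zero_of_pow_ne_one {k : Type*} [Field k] {r : k} {n : ℕ} (h : r ^ n ≠ 1) :
    ∑ l ∈ Finset.range n, r ^ l ≠ 0 := fun h0 => by
  have := geom_sum_mul r n
  rw [h0, zero_mul] at this
  exact h (sub_eq_zero.1 this.symm)

/-- Generators `x`, `y` of an algebra which satisfy `x ^ a = 0`, `x y = q y x` and `y ^ b = 0`, and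
for which the monomials `yⁱ xʲ` with `i < b` and `j < a` form a basis. -/
structure QuantumData (k : Type*) [Field k] (q : k) (a b : ℕ) (A : Type*) [Ring A]
    [Algebra k A] where
  x : A
  y : A
  a_pos : 0 < a
  b_pos : 0 < b
  x_pow : x ^ a = 0
  y_pow : y ^ b = 0
  x_mul_y : x * y = q • (y * x)
  coeff : ℕ → ℕ → A →ₗ[k] k
  coeff_monomial : ∀ i j s t,
    coeff i j (y ^ s * x ^ t) = if i = s ∧ j = t ∧ s < b ∧ t < a then 1 else 0
  sum_coeff : ∀ w, ∑ i ∈ Finset.range b, ∑ j ∈ Finset.range a, coeff i j w • (y ^ i * x ^ j) = w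
  coeff_x_mul_zero : ∀ i w, coeff i 0 (x * w) = 0
  coeff_x_mul_succ : ∀ i j w,
    coeff i (j + 1) (x * w) = if j + 1 < a then q ^ i * coeff i j w else 0
  coeff_y_mul_zero : ∀ j w, coeff 0 j (y * w) = 0
  coeff_y_mul_succ : ∀ i j w, coeff (i + 1) j (y * w) = if i + 1 < b then coeff i j w else 0

namespace QuantumData

variable {k : Type*} [Field k] {q : k} {a b : ℕ} {A : Type*} [Ring A] [Algebra k A]
  (S : QuantumData k q a b A)

theorem x_mul_y_pow (i : ℕ) : S.x * S.y ^ i = q ^ i • (S.y ^ i * S.x) := by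
  induction i with
  | zero => simp
  | succ i ih => rw [pow_succ, ← mul_assoc, ih, smul_mul_assoc, mul_assoc, S.x_mul_y, mul_smul_comm,
      smul_smul, ← mul_assoc, pow_succ]

theorem x_pow_mul_y_pow (j i : ℕ) :
    S.x ^ j * S.y ^ i = q ^ (i * j) • (S.y ^ i * S.x ^ j) := by
  induction j with
  | zero => simp
  | succ j ih => rw [pow_succ', mul_assoc, ih, mul_smul_comm, ← mul_assoc, S.x_mul_y_pow,
      smul_mul_assoc, smul_smul, mul_assoc, ← pow_succ', ← pow_add, mul_add_one]

theorem mem_of_monomial {p : Submodule k (A)} {w : A}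
    (h : ∀ i j, i < b → j < a → S.coeff i j w ≠ 0 → S.y ^ i * S.x ^ j ∈ p) : w ∈ p := by
  rw [← S.sum_coeff w]
  refine sum_mem fun i hi => sum_mem fun j hj => ?_
  by_cases h0 : S.coeff i j w = 0
  · simp [h0]
  · exact p.smul_mem _ (h i j (Finset.mem_range.1 hi) (Finset.mem_range.1 hj) h0)

theorem linearMap_ext {M : Type*} [AddCommGroup M] [Module k M] {f g : A →ₗ[k] M}
    (h : ∀ i j, i < b → j < a → f (S.y ^ i * S.x ^ j) = g (S.y ^ i * S.x ^ j)) : f = g := by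
  ext w
  exact S.mem_of_monomial (p := LinearMap.eqLocus f g) fun i j hi hj _ => h i j hi hj

/-! ### Commutators on the algebra -/

section Weights

open LinearMap (mulLeft mulRight)

theorem mulRight_x_monomial (i j : ℕ) :
    mulRight k S.x (S.y ^ i * S.x ^ j) = S.y ^ i * S.x ^ (j + 1) := by
  simp [mul_assoc, pow_succ]

theorem mulLeft_x_monomial (i j : ℕ) :
    mulLeft k S.x (S.y ^ i * S.x ^ j) = q ^ i • (S.y ^ i * S.x ^ (j + 1)) := by
  simp [← mul_assoc, S.x_mul_y_pow, pow_succ']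

theorem mulRight_y_monomial (i j : ℕ) :
    mulRight k S.y (S.y ^ i * S.x ^ j) = q ^ j • (S.y ^ (i + 1) * S.x ^ j) := by
  have := S.x_pow_mul_y_pow j 1
  rw [pow_one, one_mul] at this
  rw [LinearMap.mulRight_apply, mul_assoc, this, mul_smul_comm, ← mul_assoc, pow_succ]

theorem mulLeft_y_monomial (i j : ℕ) :
    mulLeft k S.y (S.y ^ i * S.x ^ j) = S.y ^ (i + 1) * S.x ^ j := by
  simp [← mul_assoc, pow_succ']

/-- Both multiplications by `x` raise the exponent of `x` by one, with factors `1` on the right and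
`qⁱ` on the left. On a fixed power `yⁱ` the norm therefore reduces to a geometric sum of scalars. -/
theorem geomOp_x_monomial (c : k) (i j : ℕ) :
    geomOp (mulRight k S.x) (mulLeft k S.x) c a (S.y ^ i * S.x ^ j) =
      (∑ l ∈ Finset.range a, (c * q ^ i) ^ l) • (S.y ^ i * S.x ^ (j + (a - 1))) := by
  have hT (m j : ℕ) : (mulLeft k S.x ^ m) (S.y ^ i * S.x ^ j) =
      (q ^ i) ^ m • (S.y ^ i * S.x ^ (j + m)) := by
    induction m with
    | zero => simp
    | succ m ih => rw [pow_succ', Module.End.mul_apply, ih, map_smul, S.mulLeft_x_monomial, smul_smul,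
        ← pow_succ, add_assoc]
  have hP (m j : ℕ) : (mulRight k S.x ^ m) (S.y ^ i * S.x ^ j) =
      S.y ^ i * S.x ^ (j + m) := by
    induction m with
    | zero => simp
    | succ m ih => rw [pow_succ', Module.End.mul_apply, ih, S.mulRight_x_monomial, add_assoc]
  rw [← Finset.sum_range_reflect, geomOp, LinearMap.sum_apply, Finset.sum_smul]
  refine Finset.sum_congr rfl fun l hl => ?_
  rw [Module.End.mul_apply, smul_pow, LinearMap.smul_apply, hT, smul_smul, map_smul, hP, mul_pow,
    add_assoc, Nat.sub_add_cancel (by have := Finset.mem_range.1 hl; omega)]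

theorem geomOp_y_monomial (c : k) (i j : ℕ) :
    geomOp (mulRight k S.y) (mulLeft k S.y) c b (S.y ^ i * S.x ^ j) =
      (∑ l ∈ Finset.range b, (q ^ j) ^ l * c ^ (b - 1 - l)) • (S.y ^ (i + (b - 1)) * S.x ^ j) := by
  have hT (m i : ℕ) : (mulLeft k S.y ^ m) (S.y ^ i * S.x ^ j) =
      S.y ^ (i + m) * S.x ^ j := by
    induction m with
    | zero => simp
    | succ m ih => rw [pow_succ', Module.End.mul_apply, ih, S.mulLeft_y_monomial, add_assoc]
  have hP (m i : ℕ) : (mulRight k S.y ^ m) (S.y ^ i * S.x ^ j) =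
      (q ^ j) ^ m • (S.y ^ (i + m) * S.x ^ j) := by
    induction m with
    | zero => simp
    | succ m ih => rw [pow_succ', Module.End.mul_apply, ih, map_smul, S.mulRight_y_monomial,
        smul_smul, ← pow_succ, add_assoc]
  rw [geomOp, LinearMap.sum_apply, Finset.sum_smul]
  refine Finset.sum_congr rfl fun l hl => ?_
  rw [Module.End.mul_apply, smul_pow, LinearMap.smul_apply, hT, map_smul, hP, smul_smul, mul_comm,
    add_assoc, Nat.sub_add_cancel (by have := Finset.mem_range.1 hl; omega)]

theorem coeff_sub_x (c : k) (i j : ℕ) (hj : j + 1 < a) (w : A) :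
    S.coeff i (j + 1) ((mulRight k S.x - c • mulLeft k S.x) w) =
      (1 - c * q ^ i) * S.coeff i j w := by
  suffices h : S.coeff i (j + 1) ∘ₗ (mulRight k S.x - c • mulLeft k S.x) =
      (1 - c * q ^ i) • S.coeff i j from LinearMap.congr_fun h w
  refine S.linearMap_ext fun s t hs ht => ?_
  simp only [LinearMap.comp_apply, LinearMap.sub_apply, LinearMap.smul_apply, S.mulRight_x_monomial,
    S.mulLeft_x_monomial, map_sub, map_smul, S.coeff_monomial, smul_eq_mul]
  by_cases h : i = s ∧ j = t
  · obtain ⟨rfl, rfl⟩ := h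
    simp [hj, hs, ht]
  · rw [if_neg (by omega), if_neg (by omega)]; simp

theorem coeff_geomOp_x (c : k) (i : ℕ) (w : A) :
    S.coeff i (a - 1) (geomOp (mulRight k S.x) (mulLeft k S.x) c a w) =
      (∑ l ∈ Finset.range a, (c * q ^ i) ^ l) * S.coeff i 0 w := by
  suffices h : S.coeff i (a - 1) ∘ₗ geomOp (mulRight k S.x) (mulLeft k S.x) c a =
      (∑ l ∈ Finset.range a, (c * q ^ i) ^ l) • S.coeff i 0 from LinearMap.congr_fun h w
  refine S.linearMap_ext fun s t hs ht => ?_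
  simp only [LinearMap.comp_apply, LinearMap.smul_apply, S.geomOp_x_monomial, map_smul,
    S.coeff_monomial, smul_eq_mul]
  by_cases h : i = s ∧ t = 0
  · obtain ⟨rfl, rfl⟩ := h
    simp [hs, S.a_pos]
  · rw [if_neg (by omega), if_neg (by omega)]; simp

theorem coeff_sub_y (c : k) (i : ℕ) (hi : i + 1 < b) (w : A) :
    S.coeff (i + 1) 0 ((mulRight k S.y - c • mulLeft k S.y) w) =
      (1 - c) * S.coeff i 0 w := by
  suffices h : S.coeff (i + 1) 0 ∘ₗ (mulRight k S.y - c • mulLeft k S.y) =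
      (1 - c) • S.coeff i 0 from LinearMap.congr_fun h w
  refine S.linearMap_ext fun s t hs ht => ?_
  simp only [LinearMap.comp_apply, LinearMap.sub_apply, LinearMap.smul_apply, S.mulRight_y_monomial,
    S.mulLeft_y_monomial, map_sub, map_smul, S.coeff_monomial, smul_eq_mul]
  by_cases h : i = s ∧ 0 = t
  · obtain ⟨rfl, rfl⟩ := h
    simp [hi, hs, ht]
  · rw [if_neg (by omega), if_neg (by omega)]; simp

theorem coeff_geomOp_y (c : k) (w : A) :
    S.coeff (b - 1) 0 (geomOp (mulRight k S.y) (mulLeft k S.y) c b w) =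
      (∑ l ∈ Finset.range b, c ^ l) * S.coeff 0 0 w := by
  suffices h : S.coeff (b - 1) 0 ∘ₗ geomOp (mulRight k S.y) (mulLeft k S.y) c b =
      (∑ l ∈ Finset.range b, c ^ l) • S.coeff 0 0 from LinearMap.congr_fun h w
  refine S.linearMap_ext fun s t hs ht => ?_
  simp only [LinearMap.comp_apply, LinearMap.smul_apply, S.geomOp_y_monomial, map_smul,
    S.coeff_monomial, smul_eq_mul]
  by_cases h : s = 0 ∧ t = 0
  · obtain ⟨rfl, rfl⟩ := h
    simp [S.a_pos, S.b_pos, Finset.sum_range_reflect (fun l => c ^ l) b]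
  · rw [if_neg (by omega), if_neg (by omega)]; simp

variable {c : k}

theorem coeff_zero_of_mem_range {w : A}
    (hw : w ∈ LinearMap.range (mulRight k S.x - c • mulLeft k S.x)) (i : ℕ) :
    S.coeff i 0 w = 0 := by
  obtain ⟨w, rfl⟩ := hw
  suffices h : S.coeff i 0 ∘ₗ (mulRight k S.x - c • mulLeft k S.x) = 0 from
    LinearMap.congr_fun h w
  refine S.linearMap_ext fun s t _ _ => ?_
  simp [S.mulRight_x_monomial, S.mulLeft_x_monomial, S.coeff_monomial,
    -LinearMap.mulLeft_apply, -LinearMap.mulRight_apply]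

theorem mul_x_mem_range (hc : ∀ i, c * q ^ i ≠ 1) (i j : ℕ) (hj : j ≠ 0) : S.y ^ i * S.x ^ j ∈
    LinearMap.range (mulRight k S.x - c • mulLeft k S.x) := by
  obtain ⟨j, rfl⟩ := Nat.exists_eq_succ_of_ne_zero hj
  refine ⟨(1 - c * q ^ i)⁻¹ • (S.y ^ i * S.x ^ j), ?_⟩
  rw [map_smul, LinearMap.sub_apply, LinearMap.smul_apply, S.mulRight_x_monomial, S.mulLeft_x_monomial,
    smul_smul]
  nth_rw 1 [← one_smul k (S.y ^ i * S.x ^ (j + 1))]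
  rw [← sub_smul, smul_smul, inv_mul_cancel₀ (sub_ne_zero.2 (hc i).symm), one_smul]

/-- As `1 - c qⁱ ≠ 0`, an element of the kernel has only monomials with `j = a - 1`. Each of these
is a nonzero multiple of the norm of `yⁱ`. -/
theorem mem_range_geomOp_x (hc : ∀ i, c * q ^ i ≠ 1) (hc' : ∀ i, (c * q ^ i) ^ a ≠ 1)
    {w : A} (hw : (mulRight k S.x - c • mulLeft k S.x) w = 0) :
    w ∈ LinearMap.range (geomOp (mulRight k S.x) (mulLeft k S.x) c a) := by
  refine S.mem_of_monomial fun i j hi hj h => ?_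
  have hj' : j = a - 1 := by
    by_contra hj'
    have := S.coeff_sub_x c i j (by omega) w
    rw [hw, map_zero, zero_eq_mul, or_iff_left h, sub_eq_zero] at this
    exact hc i this.symm
  refine ⟨(∑ l ∈ Finset.range a, (c * q ^ i) ^ l)⁻¹ • (S.y ^ i * S.x ^ 0), ?_⟩
  rw [map_smul, S.geomOp_x_monomial, smul_smul,
    inv_mul_cancel₀ (geom_sum_ne_zero_of_pow_ne_one (hc' i)), one_smul, hj', zero_add]

theorem mem_range_sub_x (hc : ∀ i, c * q ^ i ≠ 1) (hc' : ∀ i, (c * q ^ i) ^ a ≠ 1)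
    {w : A}
    (hw : geomOp (mulRight k S.x) (mulLeft k S.x) c a w = 0) :
    w ∈ LinearMap.range (mulRight k S.x - c • mulLeft k S.x) := by
  refine S.mem_of_monomial fun i j hi hj h => S.mul_x_mem_range hc i j ?_
  rintro rfl
  have := S.coeff_geomOp_x c i w
  rw [hw, map_zero, zero_eq_mul, or_iff_left h] at this
  exact geom_sum_ne_zero_of_pow_ne_one (hc' i) this

variable {c' d : k}

/-- This is exactness on `HH_0` modulo `x`, where only the monomials `yⁱ` matter. The constants `c`
and `d` are kept apart because source and target are divided by different `x`-relations. -/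
theorem mem_range_geomOp_y (hd : ∀ i, d * q ^ i ≠ 1) (hc : c' ≠ 1) (hc' : c' ^ b ≠ 1)
    {w : A} (hw : (mulRight k S.y - c' • mulLeft k S.y) w ∈
      LinearMap.range (mulRight k S.x - c • mulLeft k S.x)) :
    w ∈ LinearMap.range (geomOp (mulRight k S.y) (mulLeft k S.y) c' b) ⊔
      LinearMap.range (mulRight k S.x - d • mulLeft k S.x) := by
  refine S.mem_of_monomial fun i j hi hj h => ?_
  by_cases hj0 : j = 0
  swap
  · exact Submodule.mem_sup_right (S.mul_x_mem_range hd i j hj0)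
  subst hj0
  have hi' : i = b - 1 := by
    by_contra hi'
    have := S.coeff_sub_y c' i (by omega) w
    rw [S.coeff_zero_of_mem_range hw, zero_eq_mul, or_iff_left h, sub_eq_zero] at this
    exact hc this.symm
  refine Submodule.mem_sup_left ⟨(∑ l ∈ Finset.range b, c' ^ l)⁻¹ • (S.y ^ 0 * S.x ^ 0), ?_⟩
  have : ∑ l ∈ Finset.range b, (q ^ 0) ^ l * c' ^ (b - 1 - l) = ∑ l ∈ Finset.range b, c' ^ l := by
    simp [Finset.sum_range_reflect (fun l => c' ^ l) b]
  rw [map_smul, S.geomOp_y_monomial, this, smul_smul,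
    inv_mul_cancel₀ (geom_sum_ne_zero_of_pow_ne_one hc'), one_smul, hi', zero_add]

theorem mem_range_sub_y (hd : ∀ i, d * q ^ i ≠ 1) (hc : c' ≠ 1) (hc' : c' ^ b ≠ 1)
    {w : A}
    (hw : geomOp (mulRight k S.y) (mulLeft k S.y) c' b w ∈
      LinearMap.range (mulRight k S.x - c • mulLeft k S.x)) :
    w ∈ LinearMap.range (mulRight k S.y - c' • mulLeft k S.y) ⊔
      LinearMap.range (mulRight k S.x - d • mulLeft k S.x) := by
  refine S.mem_of_monomial fun i j hi hj h => ?_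
  by_cases hj0 : j = 0
  swap
  · exact Submodule.mem_sup_right (S.mul_x_mem_range hd i j hj0)
  subst hj0
  cases i with
  | zero =>
    have := S.coeff_geomOp_y c' w
    rw [S.coeff_zero_of_mem_range hw, zero_eq_mul, or_iff_left h] at this
    exact absurd this (geom_sum_ne_zero_of_pow_ne_one hc')
  | succ i =>
    refine Submodule.mem_sup_left ⟨(1 - c')⁻¹ • (S.y ^ i * S.x ^ 0), ?_⟩
    rw [map_smul, LinearMap.sub_apply, LinearMap.smul_apply, S.mulRight_y_monomial,
      S.mulLeft_y_monomial, pow_zero, one_smul]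
    nth_rw 1 [← one_smul k (S.y ^ (i + 1) * S.x ^ 0)]
    rw [← sub_smul, smul_smul, inv_mul_cancel₀ (sub_ne_zero.2 hc.symm), one_smul]

end Weights

end QuantumData

/-! ### The monomial basis of the quantum complete intersection. -/

namespace QuantumCI

variable {k : Type*} [Field k] {q : k} {a b : ℕ}

/-! ### Generators, monomials and coefficients -/

/-- The generator `X`. -/
noncomputable def x : QuantumCI q a b := RingQuot.mkAlgHom k _ (FreeAlgebra.ι k 0)

/-- The generator `Y`. -/
noncomputable def y : QuantumCI q a b := RingQuot.mkAlgHom k _ (FreeAlgebra.ι k 1)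

theorem x_pow : (x : QuantumCI q a b) ^ a = 0 := by
  rw [x, ← map_pow, RingQuot.mkAlgHom_rel k QuantumRel.pow_X, map_zero]

theorem y_pow : (y : QuantumCI q a b) ^ b = 0 := by
  rw [y, ← map_pow, RingQuot.mkAlgHom_rel k QuantumRel.pow_Y, map_zero]

theorem x_mul_y : (x : QuantumCI q a b) * y = q • (y * x) := by
  rw [x, y, ← map_mul, RingQuot.mkAlgHom_rel k QuantumRel.comm, map_smul, map_mul]

/-- The universal property. -/
noncomputable def lift {R : Type*} [Ring R] [Algebra k R] (X Y : R) (hX : X ^ a = 0)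
    (hXY : X * Y = q • (Y * X)) (hY : Y ^ b = 0) : QuantumCI q a b →ₐ[k] R :=
  RingQuot.liftAlgHom k ⟨FreeAlgebra.lift k ![X, Y], by
    rintro _ _ (_ | _ | _) <;> simp [hX, hY, hXY]⟩

section Lift

variable {R : Type*} [Ring R] [Algebra k R] {X Y : R} {hX : X ^ a = 0}
  {hXY : X * Y = q • (Y * X)} {hY : Y ^ b = 0}

@[simp] theorem lift_x : lift X Y hX hXY hY x = X := by simp [lift, x]

@[simp] theorem lift_y : lift X Y hX hXY hY y = Y := by simp [lift, y]

theorem algHom_ext {f g : QuantumCI q a b →ₐ[k] R} (hx : f x = g x) (hy : f y = g y) : f = g := by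
  apply RingQuot.ringQuot_ext'
  apply FreeAlgebra.hom_ext
  funext i
  fin_cases i
  · exact hx
  · exact hy

end Lift

theorem mul_induction {p : QuantumCI q a b → Prop} (algebraMap : ∀ c, p (algebraMap k _ c))
    (add : ∀ v w, p v → p w → p (v + w)) (mul : ∀ v w, p v → p w → p (v * w)) (hx : p x) (hy : p y)
    (w : QuantumCI q a b) : p w := by
  obtain ⟨w, rfl⟩ := RingQuot.mkAlgHom_surjective k (QuantumRel q a b) w
  induction w using FreeAlgebra.induction with
  | grade0 r => simpa using algebraMap r
  | grade1 i =>
    fin_cases i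
    · exact hx
    · exact hy
  | mul v w hv hw => rw [map_mul]; exact mul _ _ hv hw
  | add v w hv hw => rw [map_add]; exact add _ _ hv hw

theorem left_induction {p : QuantumCI q a b → Prop} (one : p 1)
    (add : ∀ v w, p v → p w → p (v + w)) (smul : ∀ (c : k) w, p w → p (c • w))
    (hx : ∀ w, p w → p (x * w)) (hy : ∀ w, p w → p (y * w)) (w : QuantumCI q a b) : p w := by
  have key (z : QuantumCI q a b) : ∀ w, p w → p (z * w) := by
    induction z using mul_induction with
    | algebraMap c => intro w hw; rw [← Algebra.smul_def]; exact smul c w hw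
    | add v z hv hz => intro w hw; rw [add_mul]; exact add _ _ (hv w hw) (hz w hw)
    | mul v z hv hz => intro w hw; rw [mul_assoc]; exact hv _ (hz w hw)
    | hx => exact hx
    | hy => exact hy
  simpa using key w 1 one

theorem x_mul_y_pow (i : ℕ) : (x : QuantumCI q a b) * y ^ i = q ^ i • (y ^ i * x) := by
  induction i with
  | zero => simp
  | succ i ih => rw [pow_succ, ← mul_assoc, ih, smul_mul_assoc, mul_assoc, x_mul_y, mul_smul_comm,
      smul_smul, ← mul_assoc, pow_succ]

/-- The action of `X` on coefficients with respect to the monomials `Yⁱ Xʲ`. -/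
def opX (q : k) (a : ℕ) : Module.End k (ℕ → ℕ → k) where
  toFun g i
    | 0 => 0
    | j + 1 => if j + 1 < a then q ^ i * g i j else 0
  map_add' g h := by
    funext i j
    cases j with
    | zero => simp
    | succ j => simp only [Pi.add_apply]; split_ifs <;> ring
  map_smul' c g := by
    funext i j
    cases j with
    | zero => simp
    | succ j => simp only [Pi.smul_apply, smul_eq_mul, RingHom.id_apply]; split_ifs <;> ring

/-- The action of `Y` on coefficients with respect to the monomials `Yⁱ Xʲ`. -/
def opY (k : Type*) [Field k] (b : ℕ) : Module.End k (ℕ → ℕ → k) where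
  toFun g
    | 0 => 0
    | i + 1 => if i + 1 < b then g i else 0
  map_add' g h := by
    funext i
    cases i with
    | zero => simp
    | succ i => simp only [Pi.add_apply]; split_ifs <;> simp
  map_smul' c g := by
    funext i
    cases i with
    | zero => simp
    | succ i => simp only [Pi.smul_apply, RingHom.id_apply]; split_ifs <;> simp

theorem opX_zero (g : ℕ → ℕ → k) (i : ℕ) : opX q a g i 0 = 0 := rfl

theorem opX_succ (g : ℕ → ℕ → k) (i j : ℕ) :
    opX q a g i (j + 1) = if j + 1 < a then q ^ i * g i j else 0 := rfl

theorem opY_zero (g : ℕ → ℕ → k) : opY k b g 0 = 0 := rfl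

theorem opY_succ (g : ℕ → ℕ → k) (i : ℕ) :
    opY k b g (i + 1) = if i + 1 < b then g i else 0 := rfl

/-- This and the two nilpotency statements below are the defining relations, so the algebra acts on
arrays of coefficients. Acting on the array supported at `(0, 0)` reads off coefficients and
separates the monomials. -/
theorem opX_mul_opY : opX q a * opY k b = q • (opY k b * opX q a) := by
  ext g i j
  simp only [Module.End.mul_apply, LinearMap.smul_apply, Pi.smul_apply, smul_eq_mul]
  cases i with
  | zero =>
    cases j with
    | zero => simp [opX_zero, opY_zero]
    | succ j => simp [opX_succ, opY_zero]
  | succ i =>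
    cases j with
    | zero => rw [opX_zero, opY_succ]; split_ifs <;> simp [opX_zero]
    | succ j =>
      rw [opX_succ, opY_succ, opY_succ]
      split_ifs <;> simp [opX_succ, *]; ring

theorem opX_pow (ha : 0 < a) : opX q a ^ a = 0 := by
  have h (m : ℕ) (g : ℕ → ℕ → k) (i j : ℕ) (hj : j < m) : (opX q a ^ m) g i j = 0 := by
    induction m generalizing j with
    | zero => omega
    | succ m ih =>
      rw [pow_succ', Module.End.mul_apply]
      cases j with
      | zero => rfl
      | succ j => rw [opX_succ, ih _ (by omega)]; simp
  ext g i j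
  by_cases hj : j < a
  · exact h a g i j hj
  -- Beyond the truncation, at indices `j ≥ a`, a single application of `opX` already gives zero.
  · obtain ⟨a, rfl⟩ := Nat.exists_eq_succ_of_ne_zero ha.ne'
    cases j with
    | zero => omega
    | succ j => rw [pow_succ', Module.End.mul_apply, opX_succ, if_neg hj]; rfl

theorem opY_pow (hb : 0 < b) : opY k b ^ b = 0 := by
  have h (m : ℕ) (g : ℕ → ℕ → k) (i : ℕ) (hi : i < m) : (opY k b ^ m) g i = 0 := by
    induction m generalizing i with
    | zero => omega
    | succ m ih =>
      rw [pow_succ', Module.End.mul_apply]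
      cases i with
      | zero => rfl
      | succ i => rw [opY_succ, ih _ (by omega)]; simp
  ext g i j
  by_cases hi : i < b
  · rw [h b g i hi]; rfl
  · obtain ⟨b, rfl⟩ := Nat.exists_eq_succ_of_ne_zero hb.ne'
    cases i with
    | zero => omega
    | succ i => rw [pow_succ', Module.End.mul_apply, opY_succ, if_neg hi]; rfl

variable [ha : Fact (0 < a)] [hb : Fact (0 < b)]

/-- The regular representation in terms of coefficients. -/
noncomputable def rep : QuantumCI q a b →ₐ[k] Module.End k (ℕ → ℕ → k) :=
  lift (opX q a) (opY k b) (opX_pow ha.out) opX_mul_opY (opY_pow hb.out)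

/-- The coefficient of `Yⁱ Xʲ`. -/
noncomputable def coeff (i j : ℕ) : QuantumCI q a b →ₗ[k] k :=
  LinearMap.proj j ∘ₗ LinearMap.proj i ∘ₗ
    LinearMap.applyₗ (fun i j : ℕ => if i = 0 ∧ j = 0 then (1 : k) else 0) ∘ₗ rep.toLinearMap

theorem coeff_one (i j : ℕ) :
    coeff i j (1 : QuantumCI q a b) = if i = 0 ∧ j = 0 then 1 else 0 := by
  simp [coeff]

theorem coeff_x_mul_zero (i : ℕ) (w : QuantumCI q a b) : coeff i 0 (x * w) = 0 := by
  simp [coeff, rep, opX_zero]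

theorem coeff_x_mul_succ (i j : ℕ) (w : QuantumCI q a b) :
    coeff i (j + 1) (x * w) = if j + 1 < a then q ^ i * coeff i j w else 0 := by
  simp [coeff, rep, opX_succ]

theorem coeff_y_mul_zero (j : ℕ) (w : QuantumCI q a b) : coeff 0 j (y * w) = 0 := by
  simp [coeff, rep, opY_zero]

theorem coeff_y_mul_succ (i j : ℕ) (w : QuantumCI q a b) :
    coeff (i + 1) j (y * w) = if i + 1 < b then coeff i j w else 0 := by
  simp only [coeff, rep, map_mul, LinearMap.comp_apply, AlgHom.toLinearMap_apply, lift_y,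
    LinearMap.applyₗ_apply_apply, Module.End.mul_apply, LinearMap.proj_apply, opY_succ]
  split_ifs <;> rfl

theorem coeff_monomial (i j s t : ℕ) : coeff i j (y ^ s * x ^ t : QuantumCI q a b) =
    if i = s ∧ j = t ∧ s < b ∧ t < a then 1 else 0 := by
  by_cases hs : s < b
  swap
  · rw [pow_eq_zero_of_le (not_lt.1 hs) y_pow]; simp [hs]
  by_cases ht : t < a
  swap
  · rw [pow_eq_zero_of_le (not_lt.1 ht) x_pow]; simp [ht]
  simp only [hs, ht, and_true]
  induction s generalizing i with
  | zero =>
    rw [pow_zero, one_mul]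
    induction t generalizing j with
    | zero => rw [pow_zero, coeff_one]
    | succ t ih =>
      rw [pow_succ']
      cases j with
      | zero => simp [coeff_x_mul_zero]
      | succ j =>
        rw [coeff_x_mul_succ, ih _ (by omega)]
        by_cases h : i = 0 ∧ j = t
        · simp [h, ht]
        · simp [h]
  | succ s ih =>
    rw [pow_succ', mul_assoc]
    cases i with
    | zero => simp [coeff_y_mul_zero]
    | succ i =>
      rw [coeff_y_mul_succ, ih _ (by omega)]
      by_cases h : i = s ∧ j = t
      · simp [h, hs]
      · simp [h]

theorem sum_coeff (w : QuantumCI q a b) : ∑ i ∈ Finset.range b, ∑ j ∈ Finset.range a,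
    coeff i j w • (y ^ i * x ^ j : QuantumCI q a b) = w := by
  have ha' := ha.out
  have hb' := hb.out
  induction w using left_induction with
  | one =>
    simp only [coeff_one]
    rw [Finset.sum_eq_single_of_mem 0 (Finset.mem_range.2 hb'),
      Finset.sum_eq_single_of_mem 0 (Finset.mem_range.2 ha')]
    · simp
    · intro j _ hj; simp [hj]
    · intro i _ hi; simp [hi]
  | add v w hv hw => simp only [map_add, add_smul, Finset.sum_add_distrib, hv, hw]
  | smul c w hw => simp only [map_smul, smul_eq_mul, mul_smul, ← Finset.smul_sum, hw]
  | hx w hw =>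
    nth_rw 2 [← hw]
    rw [Finset.mul_sum]
    refine Finset.sum_congr rfl fun i _ => ?_
    obtain ⟨n, hn⟩ := Nat.exists_eq_succ_of_ne_zero ha'.ne'
    have hr : Finset.range a = Finset.range (n + 1) := by rw [hn]
    rw [hr, Finset.sum_range_succ', coeff_x_mul_zero, Finset.sum_range_succ, mul_add]
    -- Here `n = a - 1`: the last monomial is pushed to `xᵃ = 0`, matching the truncation in
    -- `coeff_x_mul_succ`.
    have h1 : (x : QuantumCI q a b) * coeff i n w • (y ^ i * x ^ n) = 0 := by
      rw [mul_smul_comm, ← mul_assoc, x_mul_y_pow, smul_mul_assoc, mul_assoc, ← pow_succ',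
        pow_eq_zero_of_le hn.le x_pow]
      simp
    rw [h1, zero_smul, add_zero, add_zero, Finset.mul_sum]
    refine Finset.sum_congr rfl fun j hj => ?_
    rw [coeff_x_mul_succ, if_pos (by have := Finset.mem_range.1 hj; omega), mul_smul_comm,
      ← mul_assoc, x_mul_y_pow, smul_mul_assoc, mul_assoc, ← pow_succ', smul_smul, mul_comm]
  | hy w hw =>
    nth_rw 2 [← hw]
    rw [Finset.mul_sum]
    obtain ⟨n, hn⟩ := Nat.exists_eq_succ_of_ne_zero hb'.ne'
    have hr : Finset.range b = Finset.range (n + 1) := by rw [hn]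
    rw [hr, Finset.sum_range_succ', Finset.sum_range_succ]
    have h1 : (y : QuantumCI q a b) * ∑ j ∈ Finset.range a, coeff n j w • (y ^ n * x ^ j) = 0 := by
      rw [Finset.mul_sum]
      refine Finset.sum_eq_zero fun j _ => ?_
      rw [mul_smul_comm, ← mul_assoc, ← pow_succ', pow_eq_zero_of_le hn.le y_pow]
      simp
    rw [h1, Finset.sum_eq_zero (s := Finset.range a) fun j _ => by rw [coeff_y_mul_zero, zero_smul],
      add_zero, add_zero]
    refine Finset.sum_congr rfl fun i hi => ?_
    rw [Finset.mul_sum]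
    refine Finset.sum_congr rfl fun j _ => ?_
    rw [coeff_y_mul_succ, if_pos (by have := Finset.mem_range.1 hi; omega), mul_smul_comm,
      ← mul_assoc, ← pow_succ']

variable (q a b) in
/-- The presentation and the monomial basis of the quantum complete intersection. -/
noncomputable def quantumData : QuantumData k q a b (QuantumCI q a b) where
  x := x
  y := y
  a_pos := ha.out
  b_pos := hb.out
  x_pow := x_pow
  y_pow := y_pow
  x_mul_y := x_mul_y
  coeff := coeff
  coeff_monomial := coeff_monomial
  sum_coeff := sum_coeff
  coeff_x_mul_zero := coeff_x_mul_zero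
  coeff_x_mul_succ := coeff_x_mul_succ
  coeff_y_mul_zero := coeff_y_mul_zero
  coeff_y_mul_succ := coeff_y_mul_succ

end QuantumCI

/-! ### Powers of inner multiplications, intertwining maps, and shifts on tuples. -/

theorem FreeBimodule.innerL_pow {k A : Type*} [CommRing k] [Ring A] [Algebra k A] (r : A) (n : ℕ) :
    (FreeBimodule.innerL r : Module.End k (FreeBimodule k A)) ^ n = FreeBimodule.innerL (r ^ n) := by
  induction n with
  | zero => exact FreeBimodule.hom_ext fun u v => by simp
  | succ n ih =>
    rw [pow_succ', ih]
    exact FreeBimodule.hom_ext fun u v => by simp [mul_assoc, pow_succ]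

theorem FreeBimodule.innerR_pow {k A : Type*} [CommRing k] [Ring A] [Algebra k A] (r : A) (n : ℕ) :
    (FreeBimodule.innerR r : Module.End k (FreeBimodule k A)) ^ n = FreeBimodule.innerR (r ^ n) := by
  induction n with
  | zero => exact FreeBimodule.hom_ext fun u v => by simp
  | succ n ih =>
    rw [pow_succ', ih]
    exact FreeBimodule.hom_ext fun u v => by simp [← mul_assoc, pow_succ']

theorem FreeBimodule.innerL_zero {k A : Type*} [CommRing k] [Ring A] [Algebra k A] :
    (FreeBimodule.innerL 0 : Module.End k (FreeBimodule k A)) = 0 :=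
  FreeBimodule.hom_ext fun u v => by
    rw [map_tmul, LinearMap.mulRight_apply, mul_zero]
    exact TensorProduct.zero_tmul _ v

theorem FreeBimodule.innerR_zero {k A : Type*} [CommRing k] [Ring A] [Algebra k A] :
    (FreeBimodule.innerR 0 : Module.End k (FreeBimodule k A)) = 0 :=
  FreeBimodule.hom_ext fun u v => by
    rw [map_tmul, LinearMap.mulLeft_apply, zero_mul]
    exact TensorProduct.tmul_zero _ u

theorem FreeBimodule.commute_innerL_innerR {k A : Type*} [CommRing k] [Ring A] [Algebra k A]
    (r s : A) : Commute (innerL r : Module.End k (FreeBimodule k A)) (innerR s) :=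
  FreeBimodule.hom_ext fun u v => by simp

/-- If `g s ∘ G = G' ∘ g (s + 1)` for all `s`, then the powers of `G` and `G'` are intertwined. -/
theorem intertwine_pow {k E F : Type*} [CommRing k] [AddCommGroup E] [Module k E] [AddCommGroup F]
    [Module k F] {g : ℕ → E →ₗ[k] F} {G : Module.End k E} {G' : Module.End k F}
    (h : ∀ s z, g s (G z) = G' (g (s + 1) z)) (n : ℕ) :
    ∀ s z, g s ((G ^ n) z) = (G' ^ n) (g (s + n) z) := by
  induction n with
  | zero => simp
  | succ n ih =>
    intro s z
    rw [pow_succ', pow_succ', Module.End.mul_apply, Module.End.mul_apply, h, ih, add_right_comm,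
      add_assoc]

theorem intertwine_sub {k E F : Type*} [CommRing k] [AddCommGroup E] [Module k E] [AddCommGroup F]
    [Module k F] {g : ℕ → E →ₗ[k] F} {P T : Module.End k E} {P' T' : Module.End k F}
    (hP : ∀ s z, g s (P z) = P' (g (s + 1) z)) (hT : ∀ s z, g s (T z) = T' (g (s + 1) z)) (c : k)
    (s : ℕ) (z : E) : g s ((P - c • T) z) = (P' - c • T') (g (s + 1) z) := by
  simp [hP, hT]

theorem intertwine_geomOp {k E F : Type*} [CommRing k] [AddCommGroup E] [Module k E]
    [AddCommGroup F] [Module k F] {g : ℕ → E →ₗ[k] F} {P T : Module.End k E}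
    {P' T' : Module.End k F} (hP : ∀ s z, g s (P z) = P' (g (s + 1) z))
    (hT : ∀ s z, g s (T z) = T' (g (s + 1) z)) (c : k) (n s : ℕ) (z : E) :
    g s (geomOp P T c n z) = geomOp P' T' c n (g (s + (n - 1)) z) := by
  simp only [geomOp, LinearMap.sum_apply, map_sum]
  refine Finset.sum_congr rfl fun i hi => ?_
  have hi' := Finset.mem_range.1 hi
  rw [Module.End.mul_apply, intertwine_pow hP, intertwine_pow (G' := c • T')
    (fun s z => by simp [hT]), Module.End.mul_apply, add_assoc,
    show i + (n - 1 - i) = n - 1 by omega]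

/-- The shift `(g₀, …, gₙ₋₁) ↦ (0, g₀, …, gₙ₋₂)`. -/
def finShift (k M : Type*) [CommRing k] [AddCommGroup M] [Module k M] (n : ℕ) :
    Module.End k (Fin n → M) where
  toFun g
    | ⟨0, _⟩ => 0
    | ⟨l + 1, h⟩ => g ⟨l, by omega⟩
  map_add' g h := by
    funext l
    rcases l with ⟨_ | l, hl⟩ <;> simp
  map_smul' c g := by
    funext l
    rcases l with ⟨_ | l, hl⟩ <;> simp

theorem finShift_zero {k M : Type*} [CommRing k] [AddCommGroup M] [Module k M] {n : ℕ}
    (g : Fin n → M) (h : 0 < n) : finShift k M n g ⟨0, h⟩ = 0 := rfl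

theorem finShift_succ {k M : Type*} [CommRing k] [AddCommGroup M] [Module k M] {n : ℕ}
    (g : Fin n → M) (l : ℕ) (h : l + 1 < n) :
    finShift k M n g ⟨l + 1, h⟩ = g ⟨l, by omega⟩ := rfl

theorem finShift_pow {k M : Type*} [CommRing k] [AddCommGroup M] [Module k M] {n : ℕ}
    (m : ℕ) (g : Fin n → M) (l : ℕ) (h : l < n) :
    (finShift k M n ^ m) g ⟨l, h⟩ = if m ≤ l then g ⟨l - m, by omega⟩ else 0 := by
  induction m generalizing l with
  | zero => simp
  | succ m ih =>
    rw [pow_succ', Module.End.mul_apply]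
    cases l with
    | zero => simp [finShift_zero]
    | succ l => rw [finShift_succ, ih]; simp

/-- The truncated shift on tuples, together with an operator acting componentwise. -/
noncomputable def TruncatedShift.pi {k M : Type*} [Field k] [AddCommGroup M] [Module k M] {n : ℕ}
    (P₀ : Module.End k M) (h : P₀ ^ n = 0) :
    TruncatedShift k n (P₀.compLeft (Fin n)) (finShift k M n) P₀ where
  ι := LinearMap.pi fun l => if (l : ℕ) = 0 then LinearMap.id else 0
  κ l := if h : l < n then LinearMap.proj ⟨l, h⟩ else 0
  comm := by
    refine LinearMap.ext fun g => funext fun l => ?_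
    rcases l with ⟨_ | l, hl⟩
    · simp [finShift_zero]
    · simp [finShift_succ]
  P_pow := by
    have (m : ℕ) : (P₀.compLeft (Fin n)) ^ m = (P₀ ^ m).compLeft (Fin n) := by
      induction m with
      | zero => rfl
      | succ m ih => rw [pow_succ', ih, pow_succ']; rfl
    rw [this, h]; rfl
  T_pow := by
    refine LinearMap.ext fun g => funext fun l => ?_
    rw [finShift_pow, if_neg (by omega)]; rfl
  P₀_pow := h
  κ_P l m := by split_ifs <;> simp
  ι_P m := by
    funext l
    simp only [LinearMap.compLeft_apply, Function.comp_apply, LinearMap.pi_apply]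
    split_ifs <;> simp
  κ_T_zero m := by split_ifs <;> simp [finShift_zero]
  κ_T_succ l m hl := by
    rw [dif_pos hl, dif_pos (by omega)]; simp [finShift_succ]
  -- For `n = 0` the hypothesis `P₀ⁿ = 0` reads `1 = 0`, so `M` is trivial.
  κ_ι_zero m := by
    split_ifs with hn
    · simp
    · have : P₀ ^ n = 1 := by rw [Nat.eq_zero_of_not_pos hn, pow_zero]
      have h1 : (1 : Module.End k M) m = 0 := by rw [← this, h]; rfl
      simpa using h1.symm
  κ_ι_succ l m := by split_ifs <;> simp
  sum_eq m := by
    funext l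
    obtain ⟨l, hl⟩ := l
    rw [Finset.sum_apply, Finset.sum_eq_single_of_mem l (Finset.mem_range.2 hl)]
    · rw [finShift_pow]; simp [hl]
    · intro s _ hs
      rw [finShift_pow]
      split_ifs with h1 h2
      · simp [show l - s ≠ 0 by omega]
      · simp
      · rfl

/-! ### Coordinates on the free bimodule and its quotient by the relation for `x`. -/

namespace QuantumData

open FreeBimodule

variable {k : Type*} [Field k] {q : k} {a b : ℕ} {A : Type*} [Ring A] [Algebra k A]
  (S : QuantumData k q a b A)

/-- The coefficient of `xᵐ yˡ`. -/
noncomputable def coeff' (m l : ℕ) : A →ₗ[k] k := (q⁻¹) ^ (m * l) • S.coeff l m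

/-- The order `xᵐ yˡ` is the one needed in the second tensor factor: `innerR x` multiplies there
from the left and so shifts `m` without any scalar. -/
theorem sum_coeff' (hq : q ≠ 0) (v : A) : ∑ m ∈ Finset.range a, ∑ l ∈ Finset.range b,
    S.coeff' m l v • (S.x ^ m * S.y ^ l) = v := by
  rw [Finset.sum_comm]
  conv_rhs => rw [← S.sum_coeff v]
  refine Finset.sum_congr rfl fun l _ => Finset.sum_congr rfl fun m _ => ?_
  rw [S.x_pow_mul_y_pow, coeff', LinearMap.smul_apply, smul_eq_mul, smul_smul, mul_right_comm,
    mul_comm m l, ← mul_pow, inv_mul_cancel₀ hq, one_pow, one_mul]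

theorem coeff'_x_mul_zero (l : ℕ) (v : A) : S.coeff' 0 l (S.x * v) = 0 := by
  simp [coeff', S.coeff_x_mul_zero]

theorem coeff'_x_mul_succ (hq : q ≠ 0) (m l : ℕ) (hm : m + 1 < a) (v : A) :
    S.coeff' (m + 1) l (S.x * v) = S.coeff' m l v := by
  simp only [coeff', LinearMap.smul_apply, S.coeff_x_mul_succ, if_pos hm, smul_eq_mul]
  rw [← mul_assoc, add_one_mul, pow_add, mul_assoc ((q⁻¹) ^ (m * l)), ← mul_pow,
    inv_mul_cancel₀ hq, one_pow, mul_one]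

theorem coeff'_y_mul_zero (m : ℕ) (v : A) : S.coeff' m 0 (S.y * v) = 0 := by
  simp [coeff', S.coeff_y_mul_zero]

theorem coeff'_y_mul_succ (m l : ℕ) (hl : l + 1 < b) (v : A) :
    S.coeff' m (l + 1) (S.y * v) = (q⁻¹) ^ m * S.coeff' m l v := by
  simp only [coeff', LinearMap.smul_apply, S.coeff_y_mul_succ, if_pos hl, smul_eq_mul]
  rw [← mul_assoc, mul_add_one, pow_add, mul_comm ((q⁻¹) ^ (m * l))]

theorem coeff'_y_pow (m l s : ℕ) (hs : s < b) :
    S.coeff' m l (S.y ^ s) = if l = s ∧ m = 0 then 1 else 0 := by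
  have := S.coeff_monomial l m s 0
  rw [pow_zero, mul_one] at this
  rw [coeff', LinearMap.smul_apply, this]
  simp only [hs, S.a_pos, and_self, and_true]
  split_ifs with h
  · simp [h]
  · simp

/-- The coordinates of `FreeBimodule k A` with respect to `xᵐ` and the second factor. -/
noncomputable def coord (m : ℕ) : FreeBimodule k A →ₗ[k] (Fin b → A) :=
  LinearMap.pi fun l => FreeBimodule.lift ((LinearMap.lsmul k A).flip.compl₂ (S.coeff' m l))

@[simp] theorem coord_tmul (m : ℕ) (u v : A) (l : Fin b) :
    S.coord m (tmul u v) l = S.coeff' m l v • u := by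
  simp [coord]

/-- The free bimodule as a truncated shift for multiplication by `x` in the two inner places. -/
noncomputable def shiftX (hq : q ≠ 0) : TruncatedShift k a
    (innerL S.x : Module.End k (FreeBimodule k A)) (innerR S.x)
    ((LinearMap.mulRight k S.x).compLeft (Fin b)) where
  ι := ∑ l : Fin b, (FreeBimodule.mk.flip (S.y ^ (l : ℕ))) ∘ₗ LinearMap.proj l
  κ := S.coord
  comm := commute_innerL_innerR _ _
  P_pow := by
    rw [innerL_pow, S.x_pow, innerL_zero]
  T_pow := by
    rw [innerR_pow, S.x_pow, innerR_zero]
  P₀_pow := by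
    have (m : ℕ) : ((LinearMap.mulRight k S.x).compLeft (Fin b)) ^ m =
        (LinearMap.mulRight k (S.x ^ m)).compLeft (Fin b) := by
      induction m with
      | zero => ext; simp
      | succ m ih => rw [pow_succ', ih]; ext; simp [pow_succ, mul_assoc]
    rw [this, S.x_pow]; ext; simp
  κ_P m z := by
    induction z using FreeBimodule.induction with
    | hadd z w hz hw => simp only [map_add, hz, hw]
    | htmul u v => ext l; simp
  ι_P g := by simp [LinearMap.sum_apply]
  κ_T_zero z := by
    induction z using FreeBimodule.induction with
    | hadd z w hz hw => simp only [map_add, hz, hw, add_zero]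
    | htmul u v => ext l; simp [S.coeff'_x_mul_zero]
  κ_T_succ m z hm := by
    induction z using FreeBimodule.induction with
    | hadd z w hz hw => simp only [map_add, hz, hw]
    | htmul u v => ext l; simp [S.coeff'_x_mul_succ hq _ _ hm]
  κ_ι_zero g := by
    ext l
    simp [LinearMap.sum_apply, S.coeff'_y_pow, Fin.val_inj]
  κ_ι_succ m g := by
    ext l
    simp [LinearMap.sum_apply, S.coeff'_y_pow]
  sum_eq z := by
    induction z using FreeBimodule.induction with
    | hadd z w hz hw => simp only [map_add, Finset.sum_add_distrib, hz, hw]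
    | htmul u v =>
      conv_rhs => rw [← S.sum_coeff' hq v, ← mk_apply, map_sum]
      refine Finset.sum_congr rfl fun m _ => ?_
      rw [map_sum, innerR_pow, LinearMap.sum_apply, map_sum, Finset.sum_range]
      refine Finset.sum_congr rfl fun l _ => ?_
      simp

/-- The tuples over `A` as a truncated shift for multiplication by `y`. -/
noncomputable def shiftY : TruncatedShift k b ((LinearMap.mulRight k S.y).compLeft (Fin b))
    (finShift k A b) (LinearMap.mulRight k S.y) :=
  TruncatedShift.pi _ (by rw [LinearMap.pow_mulRight, S.y_pow]; simp)

/-- The projections of the free bimodule to the quotient by `x ⊗ 1 - qˢ 1 ⊗ x`. -/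
noncomputable def projX (hq : q ≠ 0) (s : ℕ) : FreeBimodule k A →ₗ[k] (Fin b → A) :=
  (S.shiftX hq).proj (q ^ s)

/-- In the quotient each `x` crosses the tensor sign from right to left at the cost of `q⁻ˢ`,
leaving only powers of `y` in the second factor. This identifies the quotient with `Aᵇ`. -/
theorem projX_tmul (hq : q ≠ 0) (s : ℕ) (u v : A) (l : Fin b) :
    S.projX hq s (tmul u v) l =
      ∑ m ∈ Finset.range a, ((q ^ s)⁻¹ ^ m * S.coeff' m l v) • (u * S.x ^ m) := by
  have h (m : ℕ) (g : Fin b → A) : ((LinearMap.mulRight k S.x).compLeft (Fin b) ^ m) g l =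
      g l * S.x ^ m := by
    induction m generalizing g with
    | zero => simp
    | succ m ih => rw [pow_succ, Module.End.mul_apply, ih]; simp [pow_succ', mul_assoc]
  rw [projX, TruncatedShift.proj_apply, Finset.sum_apply]
  refine Finset.sum_congr rfl fun m _ => ?_
  rw [Pi.smul_apply, h]
  change _ • (S.coord m (tmul u v) l * _) = _
  rw [coord_tmul, smul_mul_assoc, smul_smul]

/-- The factor `qᵐ` from moving `y` past `xᵐ` turns the weight `q⁻⁽ˢ⁺¹⁾ᵐ` into `q⁻ˢᵐ`. This is the
source of the change of parameter between consecutive quotients. -/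
theorem projX_innerL_y (hq : q ≠ 0) (s : ℕ) (z : FreeBimodule k A) :
    S.projX hq s (innerL S.y z) =
      (LinearMap.mulRight k S.y).compLeft (Fin b) (S.projX hq (s + 1) z) := by
  induction z using FreeBimodule.induction with
  | hadd z w hz hw => simp only [map_add, hz, hw]
  | htmul u v =>
    ext l
    rw [map_tmul, projX_tmul, LinearMap.compLeft_apply, Function.comp_apply, projX_tmul, map_sum]
    refine Finset.sum_congr rfl fun m _ => ?_
    have h := S.x_pow_mul_y_pow m 1
    rw [pow_one, one_mul] at h
    simp only [LinearMap.id_apply, LinearMap.mulRight_apply, smul_mul_assoc, mul_assoc, h,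
      mul_smul_comm, smul_smul]
    congr 1
    rw [pow_succ, mul_inv, mul_pow, mul_right_comm, mul_assoc ((q ^ s)⁻¹ ^ m), mul_assoc,
      ← mul_pow, mul_inv_cancel₀ hq, one_pow, mul_one]

theorem projX_innerR_y (hq : q ≠ 0) (s : ℕ) (z : FreeBimodule k A) :
    S.projX hq s (innerR S.y z) = finShift k A b (S.projX hq (s + 1) z) := by
  induction z using FreeBimodule.induction with
  | hadd z w hz hw => simp only [map_add, hz, hw]
  | htmul u v =>
    ext ⟨l, hl⟩
    rw [map_tmul, projX_tmul]
    cases l with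
    | zero => simp [finShift_zero, S.coeff'_y_mul_zero]
    | succ l =>
      rw [finShift_succ, projX_tmul]
      refine Finset.sum_congr rfl fun m _ => ?_
      simp only [LinearMap.id_apply, LinearMap.mulLeft_apply, S.coeff'_y_mul_succ _ _ hl]
      rw [pow_succ q s, mul_inv, mul_pow, mul_assoc]

/-! ### Exactness of the sequences of inner multiplications -/

/-- The operator `x ⊗ 1 - qˢ 1 ⊗ x` on the free bimodule. -/
noncomputable def subX (s : ℕ) : Module.End k (FreeBimodule k A) :=
  innerL S.x - q ^ s • innerR S.x

/-- The norm operator associated with `subX`. -/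
noncomputable def normX (s : ℕ) : Module.End k (FreeBimodule k A) :=
  geomOp (innerL S.x) (innerR S.x) (q ^ s) a

/-- The operator `y ⊗ 1 - c 1 ⊗ y` on the free bimodule. -/
noncomputable def subY (c : k) : Module.End k (FreeBimodule k A) :=
  innerL S.y - c • innerR S.y

/-- The norm operator associated with `subY`. -/
noncomputable def normY (c : k) : Module.End k (FreeBimodule k A) :=
  geomOp (innerL S.y) (innerR S.y) c b

theorem subX_normX (hq : q ≠ 0) (s : ℕ) (z : FreeBimodule k A) :
    S.subX s (S.normX s z) = 0 := (S.shiftX hq).sub_geomOp _ z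

theorem normX_subX (hq : q ≠ 0) (s : ℕ) (z : FreeBimodule k A) :
    S.normX s (S.subX s z) = 0 := (S.shiftX hq).geomOp_sub _ z

theorem mem_range_normX (hq : q ≠ 0) {s : ℕ} {z : FreeBimodule k A} (hz : S.subX s z = 0) :
    z ∈ LinearMap.range (S.normX s) := (S.shiftX hq).mem_range_geomOp (pow_ne_zero _ hq) hz

theorem mem_range_subX (hq : q ≠ 0) {s : ℕ} {z : FreeBimodule k A} (hz : S.normX s z = 0) :
    z ∈ LinearMap.range (S.subX s) :=
  (S.shiftX hq).mem_range_sub S.a_pos (pow_ne_zero _ hq) hz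

theorem projX_eq_zero_iff (hq : q ≠ 0) {s : ℕ} {z : FreeBimodule k A} :
    S.projX hq s z = 0 ↔ z ∈ LinearMap.range (S.subX s) :=
  (S.shiftX hq).proj_eq_zero_iff (pow_ne_zero _ hq) z

theorem projX_surjective (hq : q ≠ 0) (s : ℕ) : Function.Surjective (S.projX hq s) := fun g =>
  ⟨(S.shiftX hq).ι g, (S.shiftX hq).proj_ι S.a_pos _ g⟩

theorem projX_subY (hq : q ≠ 0) (c : k) (s : ℕ) (z : FreeBimodule k A) :
    S.projX hq s (S.subY c z) = ((LinearMap.mulRight k S.y).compLeft (Fin b) -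
      c • finShift k A b : Module.End k (Fin b → A)) (S.projX hq (s + 1) z) :=
  intertwine_sub (S.projX_innerL_y hq) (S.projX_innerR_y hq) c s z

theorem projX_normY (hq : q ≠ 0) (c : k) (s : ℕ) (z : FreeBimodule k A) :
    S.projX hq s (S.normY c z) = geomOp ((LinearMap.mulRight k S.y).compLeft (Fin b) :
      Module.End k (Fin b → A)) (finShift k A b) c b (S.projX hq (s + (b - 1)) z) :=
  intertwine_geomOp (S.projX_innerL_y hq) (S.projX_innerR_y hq) c b s z

theorem subY_mem_range_subX (hq : q ≠ 0) {c : k} {s : ℕ} {z : FreeBimodule k A}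
    (hz : z ∈ LinearMap.range (S.subX (s + 1))) : S.subY c z ∈ LinearMap.range (S.subX s) := by
  rw [← S.projX_eq_zero_iff hq] at hz ⊢
  rw [projX_subY, hz, map_zero]

theorem normY_mem_range_subX (hq : q ≠ 0) {c : k} {s : ℕ} {z : FreeBimodule k A}
    (hz : z ∈ LinearMap.range (S.subX (s + (b - 1)))) :
    S.normY c z ∈ LinearMap.range (S.subX s) := by
  rw [← S.projX_eq_zero_iff hq] at hz ⊢
  rw [projX_normY, hz, map_zero]

theorem subY_normY (c : k) (z : FreeBimodule k A) : S.subY c (S.normY c z) = 0 := by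
  rw [subY, normY, ← Module.End.mul_apply, sub_mul_geomOp (commute_innerL_innerR _ _), smul_pow,
    innerL_pow, innerR_pow, S.y_pow, innerL_zero, innerR_zero]
  simp

theorem normY_subY (c : k) (z : FreeBimodule k A) : S.normY c (S.subY c z) = 0 := by
  rw [subY, normY, ← Module.End.mul_apply, geomOp_mul_sub (commute_innerL_innerR _ _), smul_pow,
    innerL_pow, innerR_pow, S.y_pow, innerL_zero, innerR_zero]
  simp

/-- After projection to `Aᵇ` the two inner multiplications by `y` form a truncated shift, which is
exact. Preimages are lifted back along the surjective projection. -/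
theorem mem_range_normY (hq : q ≠ 0) {c : k} (hc : c ≠ 0) {s : ℕ} {z : FreeBimodule k A}
    (hz : S.subY c z ∈ LinearMap.range (S.subX s)) :
    z ∈ LinearMap.range (S.normY c) ⊔ LinearMap.range (S.subX (s + 1)) := by
  rw [← S.projX_eq_zero_iff hq, projX_subY] at hz
  obtain ⟨t, ht⟩ := S.shiftY.mem_range_geomOp hc hz
  obtain ⟨w, rfl⟩ := S.projX_surjective hq (s + 1 + (b - 1)) t
  rw [← projX_normY] at ht
  rw [← add_sub_cancel (S.normY c w) z]
  refine Submodule.add_mem_sup ⟨w, rfl⟩ ?_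
  rw [← S.projX_eq_zero_iff hq, map_sub, ht, sub_self]

theorem mem_range_subY (hq : q ≠ 0) {c : k} (hc : c ≠ 0) {s : ℕ} {z : FreeBimodule k A}
    (hz : S.normY c z ∈ LinearMap.range (S.subX s)) :
    z ∈ LinearMap.range (S.subY c) ⊔ LinearMap.range (S.subX (s + (b - 1))) := by
  rw [← S.projX_eq_zero_iff hq, projX_normY] at hz
  obtain ⟨t, ht⟩ := S.shiftY.mem_range_sub S.b_pos hc hz
  obtain ⟨w, rfl⟩ := S.projX_surjective hq (s + (b - 1) + 1) t
  rw [← projX_subY] at ht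
  rw [← add_sub_cancel (S.subY c w) z]
  refine Submodule.add_mem_sup ⟨w, rfl⟩ ?_
  rw [← S.projX_eq_zero_iff hq, map_sub, ht, sub_self]

theorem subX_mem_bimoduleEnd (s : ℕ) : S.subX s ∈ bimoduleEnd k A :=
  sub_mem (innerL_mem _) (Subalgebra.smul_mem _ (innerR_mem _) _)

theorem normX_mem_bimoduleEnd (s : ℕ) : S.normX s ∈ bimoduleEnd k A :=
  sum_mem fun _ _ => mul_mem (pow_mem (innerL_mem _) _)
    (pow_mem (Subalgebra.smul_mem _ (innerR_mem _) _) _)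

theorem subY_mem_bimoduleEnd (c : k) : S.subY c ∈ bimoduleEnd k A :=
  sub_mem (innerL_mem _) (Subalgebra.smul_mem _ (innerR_mem _) _)

theorem normY_mem_bimoduleEnd (c : k) : S.normY c ∈ bimoduleEnd k A :=
  sum_mem fun _ _ => mul_mem (pow_mem (innerL_mem _) _)
    (pow_mem (Subalgebra.smul_mem _ (innerR_mem _) _) _)

end QuantumData

/-! ### Transfer of acyclicity to quotients of the free bimodule. -/

theorem rTensor_mem_range {k E F G : Type*} [CommRing k] [AddCommGroup E] [Module k E]
    [AddCommGroup F] [Module k F] [AddCommGroup G] [Module k G] {h : E →ₗ[k] F} {w : G →ₗ[k] F}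
    (H : ∀ x, h x ∈ LinearMap.range w) (V : Type*) [AddCommGroup V] [Module k V] (z : E ⊗[k] V) :
    h.rTensor V z ∈ LinearMap.range (w.rTensor V) := by
  induction z using TensorProduct.induction_on with
  | zero => simp
  | add x y hx hy => rw [map_add]; exact add_mem hx hy
  | tmul x v =>
    obtain ⟨t, ht⟩ := H x
    exact ⟨t ⊗ₜ v, by simp [ht]⟩

namespace FreeBimodule

variable {k A : Type*} [Field k] [Ring A] [Algebra k A]

variable (k A) in
/-- The linear map `u ⊗ v ↦ v u`. -/
noncomputable def mulFlip : FreeBimodule k A →ₗ[k] A := lift (LinearMap.mul k A).flip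

@[simp] theorem mulFlip_tmul (u v : A) : mulFlip k A (tmul u v) = v * u := by simp [mulFlip]

theorem mulFlip_innerL (r : A) (z : FreeBimodule k A) :
    mulFlip k A (innerL r z) = LinearMap.mulRight k r (mulFlip k A z) := by
  induction z using induction with
  | hadd z w hz hw => simp only [map_add, hz, hw]
  | htmul u v => simp [mul_assoc]

theorem mulFlip_innerR (r : A) (z : FreeBimodule k A) :
    mulFlip k A (innerR r z) = LinearMap.mulLeft k r (mulFlip k A z) := by
  induction z using induction with
  | hadd z w hz hw => simp only [map_add, hz, hw]
  | htmul u v => simp [mul_assoc]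

/-- The augmentation identifies `HH_0` of the free bimodule with `A`; this translates exactness on
`HH_0` into a statement about operators on `A`. -/
theorem augmentation_map {f : Module.End k (FreeBimodule k A)} {g : Module.End k A}
    (h : ∀ z, mulFlip k A (f z) = g (mulFlip k A z))
    (z : HochschildChain k A (FreeBimodule k A) 0) :
    augmentation k A (hochschildMap A f 0 z) = g (augmentation k A z) := by
  have haug (e : FreeBimodule k A) (t : Fin 0 → A) :
      augmentation k A (e ⊗ₜ[k] PiTensorProduct.tprod k t) = mulFlip k A e := by
    simp [augmentation, mulFlip]
  induction z using HochschildChain.induction with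
  | hadd x y hx hy => simp only [map_add, hx, hy]
  | htmul e t => rw [LinearMap.rTensor_tmul, haug, haug, h]

/-- A periodic family of bimodule endomorphisms `f i` of the free bimodule `E`, such that the
sequence of all `E / w (σ i) → E / w i` is exact and remains exact on Hochschild homology in degree
zero, transfers acyclicity of the Hochschild complex from `E / w i` to `E / (f i, w i)`. -/
theorem acyclic_of_periodic {I : Type*} (σ : I → I) (f w : I → Module.End k (FreeBimodule k A))
    (hf : ∀ i, f i ∈ bimoduleEnd k A) (hw : ∀ i, w i ∈ bimoduleEnd k A)
    (f' w' : I → Module.End k A)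
    (hf' : ∀ i z, mulFlip k A (f i z) = f' i (mulFlip k A z))
    (hw' : ∀ i z, mulFlip k A (w i z) = w' i (mulFlip k A z))
    (hfw : ∀ i z, f i (w (σ i) z) ∈ LinearMap.range (w i))
    (hff : ∀ i z, f i (f (σ i) z) ∈ LinearMap.range (w i))
    (hfe : ∀ i z, f i z ∈ LinearMap.range (w i) →
      z ∈ LinearMap.range (f (σ i)) ⊔ LinearMap.range (w (σ i)))
    (hA : ∀ i z, f' i z ∈ LinearMap.range (w' i) →
      z ∈ LinearMap.range (f' (σ i)) ⊔ LinearMap.range (w' (σ i)))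
    (hex : ∀ i n z, hochschildD k A _ n z ∈ LinearMap.range (hochschildMap A (w i) n) →
      z ∈ LinearMap.range (hochschildMap A (w i) (n + 1)) ⊔
        LinearMap.range (hochschildD k A _ (n + 1)))
    (n : ℕ) (i : I) (z : HochschildChain k A (FreeBimodule k A) (n + 1))
    (hz : hochschildD k A _ n z ∈ LinearMap.range (hochschildMap A (f i) n) ⊔
      LinearMap.range (hochschildMap A (w i) n)) :
    z ∈ LinearMap.range (hochschildMap A (f i) (n + 1)) ⊔
      LinearMap.range (hochschildMap A (w i) (n + 1)) ⊔
        LinearMap.range (hochschildD k A _ (n + 1)) := by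
  refine acyclic_coker_of_periodic (C := HochschildChain k A (FreeBimodule k A))
    (hochschildD k A _) hochschildD_hochschildD σ (fun i n => hochschildMap A (f i) n)
    (fun i n => LinearMap.range (hochschildMap A (w i) n))
    (fun i n z => hochschildD_map (hf i) n z) ?_ ?_ ?_ ?_ ?_ hex n i z hz
  · rintro i n _ ⟨z, rfl⟩
    exact ⟨_, (hochschildD_map (hw i) n z).symm⟩
  · rintro i n _ ⟨z, rfl⟩
    rw [← LinearMap.comp_apply, ← LinearMap.rTensor_comp]
    exact rTensor_mem_range (hfw i) _ z
  · intro i n z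
    rw [← LinearMap.comp_apply, ← LinearMap.rTensor_comp]
    exact rTensor_mem_range (hff i) _ z
  · intro i n z hz
    exact rTensor_mem_range_sup (hff i) (hfw i) (hfe i) _ hz
  · intro i z hz
    have h0 : augmentation k A (hochschildMap A (f i) 0 z) ∈ LinearMap.range (w' i) := by
      obtain ⟨_, ⟨t, rfl⟩, _, ⟨t', rfl⟩, h⟩ := Submodule.mem_sup.1 hz
      rw [← h, map_add, augmentation_hochschildD, add_zero, augmentation_map (hw' i)]
      exact ⟨_, rfl⟩
    rw [augmentation_map (hf' i)] at h0
    obtain ⟨_, ⟨t, rfl⟩, _, ⟨t', rfl⟩, h⟩ := Submodule.mem_sup.1 (hA i _ h0)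
    obtain ⟨t, rfl⟩ := augmentation_surjective (k := k) t
    obtain ⟨t', rfl⟩ := augmentation_surjective (k := k) t'
    rw [← augmentation_map (hf' _), ← augmentation_map (hw' _), ← map_add] at h
    -- Two chains of degree zero with the same augmentation differ by a boundary.
    have := mem_range_hochschildD_zero (z := z - (hochschildMap A (f (σ i)) 0 t +
      hochschildMap A (w (σ i)) 0 t')) (by rw [map_sub, h, sub_self])
    rw [← add_sub_cancel (hochschildMap A (f (σ i)) 0 t + hochschildMap A (w (σ i)) 0 t') z]
    exact Submodule.add_mem_sup (Submodule.add_mem_sup ⟨t, rfl⟩ ⟨t', rfl⟩) this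

end FreeBimodule

/-! ### Vanishing after imposing the relations for `x` and `y`. -/

namespace QuantumData

open FreeBimodule LinearMap

variable {k : Type*} [Field k] {q : k} {a b : ℕ} {A : Type*} [Ring A] [Algebra k A]
  (S : QuantumData k q a b A)

theorem mulFlip_subX (s : ℕ) (z : FreeBimodule k A) : mulFlip k A (S.subX s z) =
    (mulRight k S.x - q ^ s • mulLeft k S.x) (mulFlip k A z) :=
  intertwine_sub (g := fun _ => mulFlip k A) (fun _ => mulFlip_innerL _)
    (fun _ => mulFlip_innerR _) _ 0 z

theorem mulFlip_normX (s : ℕ) (z : FreeBimodule k A) : mulFlip k A (S.normX s z) =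
    geomOp (mulRight k S.x) (mulLeft k S.x) (q ^ s) a (mulFlip k A z) :=
  intertwine_geomOp (g := fun _ => mulFlip k A) (fun _ => mulFlip_innerL _)
    (fun _ => mulFlip_innerR _) _ a 0 z

theorem mulFlip_subY (c : k) (z : FreeBimodule k A) : mulFlip k A (S.subY c z) =
    (mulRight k S.y - c • mulLeft k S.y) (mulFlip k A z) :=
  intertwine_sub (g := fun _ => mulFlip k A) (fun _ => mulFlip_innerL _)
    (fun _ => mulFlip_innerR _) _ 0 z

theorem mulFlip_normY (c : k) (z : FreeBimodule k A) : mulFlip k A (S.normY c z) =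
    geomOp (mulRight k S.y) (mulLeft k S.y) c b (mulFlip k A z) :=
  intertwine_geomOp (g := fun _ => mulFlip k A) (fun _ => mulFlip_innerL _)
    (fun _ => mulFlip_innerR _) _ b 0 z

variable (hq0 : q ≠ 0) (hq : ∀ m : ℕ, 1 ≤ m → q ^ m ≠ 1)

include hq in
theorem pow_mul_pow_ne_one {s : ℕ} (hs : 1 ≤ s) (i : ℕ) : q ^ s * q ^ i ≠ 1 := by
  rw [← pow_add]; exact hq _ (by omega)

include hq in
theorem pow_mul_pow_pow_ne_one {s n : ℕ} (hs : 1 ≤ s) (hn : 0 < n) (i : ℕ) :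
    (q ^ s * q ^ i) ^ n ≠ 1 := by
  rw [← pow_add, ← pow_mul]; exact hq _ (Nat.mul_pos (by omega) hn)

include hq0 hq in
theorem acyclic_subX {s : ℕ} (hs : 1 ≤ s) (n : ℕ)
    (z : HochschildChain k A (FreeBimodule k A) (n + 1))
    (hz : hochschildD k A _ n z ∈ range (hochschildMap A (S.subX s) n)) :
    z ∈ range (hochschildMap A (S.subX s) (n + 1)) ⊔ range (hochschildD k A _ (n + 1)) := by
  have h1 := pow_mul_pow_ne_one hq hs
  have h2 := pow_mul_pow_pow_ne_one hq hs S.a_pos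
  have h0 (n : ℕ) : hochschildMap A (0 : Module.End k (FreeBimodule k A)) n = 0 :=
    LinearMap.rTensor_zero _
  -- The relations `w` are zero here, so the starting point is the free bimodule itself; `false`
  -- stands for `subX` and `true` for `normX`.
  have key := acyclic_of_periodic (I := Bool) (A := A) not
    (fun i => cond i (S.normX s) (S.subX s)) 0
    (by rintro (_ | _); exacts [S.subX_mem_bimoduleEnd s, S.normX_mem_bimoduleEnd s])
    (fun _ => zero_mem _)
    (fun i => cond i (geomOp (mulRight k S.x) (mulLeft k S.x) (q ^ s) a)
      (mulRight k S.x - q ^ s • mulLeft k S.x)) 0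
    (by rintro (_ | _) z; exacts [S.mulFlip_subX s z, S.mulFlip_normX s z])
    (fun _ z => by simp) (fun i z => by simp)
    (by
      rintro (_ | _) z
      · exact ⟨0, by simp [S.subX_normX hq0]⟩
      · exact ⟨0, by simp [S.normX_subX hq0]⟩)
    (by
      rintro (_ | _) z ⟨t, ht⟩
      · exact Submodule.mem_sup_left (S.mem_range_normX hq0 (by simpa using ht.symm))
      · exact Submodule.mem_sup_left (S.mem_range_subX hq0 (by simpa using ht.symm)))
    (by
      rintro (_ | _) z ⟨t, ht⟩
      · exact Submodule.mem_sup_left (S.mem_range_geomOp_x h1 h2 (by simpa using ht.symm))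
      · exact Submodule.mem_sup_left (S.mem_range_sub_x h1 h2 (by simpa using ht.symm)))
    (by
      rintro i n z ⟨t, ht⟩
      simp only [Pi.zero_apply, h0, LinearMap.zero_apply] at ht
      exact Submodule.mem_sup_right (mem_range_hochschildD ht.symm))
    n false z (Submodule.mem_sup_left hz)
  simpa only [Pi.zero_apply, h0, LinearMap.range_zero, sup_bot_eq, cond_false] using key

include hq0 hq in
theorem acyclic_subX_subY {c : k} (hc0 : c ≠ 0) (hc : c ≠ 1) (hcb : c ^ b ≠ 1) {s : ℕ}
    (hs : 1 ≤ s) (n : ℕ) (z : HochschildChain k A (FreeBimodule k A) (n + 1))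
    (hz : hochschildD k A _ n z ∈
      range (hochschildMap A (S.subY c) n) ⊔ range (hochschildMap A (S.subX s) n)) :
    z ∈ range (hochschildMap A (S.subY c) (n + 1)) ⊔ range (hochschildMap A (S.subX s) (n + 1)) ⊔
      range (hochschildD k A _ (n + 1)) := by
  have h1 (s : ℕ) (i : ℕ) := pow_mul_pow_ne_one hq (s := s + 1) (by omega) i
  have hs1 : s - 1 + 1 = s := by omega
  -- An index with first entry `s` refers to the relation `subX (s + 1)`, so all parameters that
  -- occur are at least `1`. The source of `subY` has its parameter raised by `1`, that of `normY`
  -- by `b - 1`, the degree of the norm in `y`.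
  have key := acyclic_of_periodic (I := ℕ × Bool) (A := A)
    (fun i => (cond i.2 (i.1 + (b - 1)) (i.1 + 1), !i.2))
    (fun i => cond i.2 (S.normY c) (S.subY c)) (fun i => S.subX (i.1 + 1))
    (by rintro ⟨s, _ | _⟩; exacts [S.subY_mem_bimoduleEnd c, S.normY_mem_bimoduleEnd c])
    (fun _ => S.subX_mem_bimoduleEnd _)
    (fun i => cond i.2 (geomOp (mulRight k S.y) (mulLeft k S.y) c b)
      (mulRight k S.y - c • mulLeft k S.y))
    (fun i => mulRight k S.x - q ^ (i.1 + 1) • mulLeft k S.x)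
    (by rintro ⟨s, _ | _⟩ z; exacts [S.mulFlip_subY c z, S.mulFlip_normY c z])
    (fun _ z => S.mulFlip_subX _ z)
    (by
      rintro ⟨s, _ | _⟩ z
      · exact S.subY_mem_range_subX hq0 ⟨z, rfl⟩
      · refine S.normY_mem_range_subX hq0 ⟨z, ?_⟩
        rw [add_right_comm]; rfl)
    (by
      rintro ⟨s, _ | _⟩ z
      · exact ⟨0, by simp [S.subY_normY]⟩
      · exact ⟨0, by simp [S.normY_subY]⟩)
    (by
      rintro ⟨s, _ | _⟩ z hz
      · exact S.mem_range_normY hq0 hc0 hz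
      · have := S.mem_range_subY hq0 hc0 hz
        rwa [add_right_comm] at this)
    (by
      rintro ⟨s, _ | _⟩ z hz
      · exact S.mem_range_geomOp_y (h1 _) hc hcb hz
      · exact S.mem_range_sub_y (h1 _) hc hcb hz)
    (fun i n z hz => S.acyclic_subX hq0 hq (by omega) n z hz)
    n (s - 1, false) z (by simpa only [hs1, cond_false] using hz)
  simpa only [hs1, cond_false] using key

include hq0 hq in
/-- Vanishing of Hochschild homology for a bimodule which is generated by one element subject to
the relations `x m = qˢ m x` and `y m = c m y`. -/
theorem mem_boundaries_of_cyclic {c : k} (hc0 : c ≠ 0) (hc : c ≠ 1) (hcb : c ^ b ≠ 1) {s : ℕ}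
    (hs : 1 ≤ s) {B : Type*} [AddCommGroup B] [Module k B] [Module A B] [Module Aᵐᵒᵖ B]
    [IsScalarTower k A B] [IsScalarTower k Aᵐᵒᵖ B] (π : FreeBimodule k A →ₗ[k] B)
    (hl : ∀ (l : A) z, π (l • z) = l • π z) (hr : ∀ (r : Aᵐᵒᵖ) z, π (r • z) = r • π z)
    (hsurj : Function.Surjective π) (hX : ∀ z, π (S.subX s z) = 0) (hY : ∀ z, π (S.subY c z) = 0)
    (hker : ∀ z, π z = 0 → z ∈ range (S.subY c) ⊔ range (S.subX s)) (n : ℕ)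
    (z : HochschildChain k A B (n + 1)) (hz : hochschildD k A B n z = 0) :
    z ∈ range (hochschildD k A B (n + 1)) := by
  obtain ⟨z, rfl⟩ := LinearMap.rTensor_surjective (⨂[k] _i : Fin (n + 1), A) hsurj z
  rw [_root_.hochschildD_map π hl hr] at hz
  have h1 : hochschildD k A _ n z ∈
      range (hochschildMap A (S.subY c) n) ⊔ range (hochschildMap A (S.subX s) n) := by
    refine rTensor_mem_range_sup (w := (0 : FreeBimodule k A →ₗ[k] B)) (h := π)
      (fun z => by simp [hY]) (fun z => by simp [hX]) (fun z hz => hker z ?_) _ ?_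
    · simpa [eq_comm] using hz
    · rw [hz]; exact zero_mem _
  obtain ⟨_, h2, _, ⟨t, rfl⟩, rfl⟩ := Submodule.mem_sup.1
    (S.acyclic_subX_subY hq0 hq hc0 hc hcb hs n z h1)
  obtain ⟨_, ⟨t₁, rfl⟩, _, ⟨t₂, rfl⟩, rfl⟩ := Submodule.mem_sup.1 h2
  -- The lifted chain is a boundary up to images of `subX` and `subY`, and `π` annihilates both.
  refine ⟨hochschildMap A π (n + 2) t, ?_⟩
  have h0 {f : Module.End k (FreeBimodule k A)} (hf : ∀ z, π (f z) = 0)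
      (z : HochschildChain k A (FreeBimodule k A) (n + 1)) :
      hochschildMap A π (n + 1) (hochschildMap A f (n + 1) z) = 0 := by
    have h1 : hochschildMap A π (n + 1) ∘ₗ hochschildMap A f (n + 1) = 0 := by
      rw [← LinearMap.rTensor_comp, show π ∘ₗ f = 0 from LinearMap.ext hf, LinearMap.rTensor_zero]
    exact LinearMap.congr_fun h1 z
  rw [_root_.hochschildD_map π hl hr, map_add, map_add, h0 hX, h0 hY, zero_add, zero_add]

/-! ### The Frobenius form -/

section Frobenius

theorem mem_subalgebra {p : Subalgebra k A} (hx : S.x ∈ p) (hy : S.y ∈ p) (w : A) : w ∈ p :=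
  S.mem_of_monomial (p := Subalgebra.toSubmodule p) fun i j _ _ _ =>
    p.mul_mem (p.pow_mem hy i) (p.pow_mem hx j)

/-- The coefficient of the socle element `yᵇ⁻¹ xᵃ⁻¹`. -/
noncomputable def form : A →ₗ[k] k := S.coeff (b - 1) (a - 1)

/-- Multiplication by the complementary monomial moves `yⁱ xʲ`, and no other basis monomial, to the
socle. All coefficients are thus visible to the form, which makes it nondegenerate. -/
theorem form_monomial_mul {i j : ℕ} (hi : i < b) (hj : j < a) (w : A) :
    S.form (S.y ^ (b - 1 - i) * S.x ^ (a - 1 - j) * w) =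
      q ^ (i * (a - 1 - j)) * S.coeff i j w := by
  suffices h : S.form ∘ₗ mulLeft k (S.y ^ (b - 1 - i) * S.x ^ (a - 1 - j)) =
      q ^ (i * (a - 1 - j)) • S.coeff i j from LinearMap.congr_fun h w
  refine S.linearMap_ext fun s t hs ht => ?_
  rw [LinearMap.comp_apply, LinearMap.mulLeft_apply, mul_assoc, ← mul_assoc (S.x ^ _),
    S.x_pow_mul_y_pow, smul_mul_assoc, mul_smul_comm, mul_assoc (S.y ^ s), ← pow_add, ← mul_assoc,
    ← pow_add, map_smul, form, S.coeff_monomial, LinearMap.smul_apply, S.coeff_monomial]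
  by_cases h : i = s ∧ j = t
  · obtain ⟨rfl, rfl⟩ := h
    rw [if_pos (by omega), if_pos (by omega)]
  · rw [if_neg (by omega), if_neg (by omega)]; simp

include hq0 in
theorem eq_zero_of_form {w : A} (hw : ∀ l, S.form (l * w) = 0) : w = 0 := by
  rw [← S.sum_coeff w]
  refine Finset.sum_eq_zero fun i hi => Finset.sum_eq_zero fun j hj => ?_
  have := S.form_monomial_mul (Finset.mem_range.1 hi) (Finset.mem_range.1 hj) w
  rw [hw, zero_eq_mul, or_iff_right (pow_ne_zero _ hq0)] at this
  rw [this, zero_smul]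

include S in
theorem finite : Module.Finite k A := by
  refine Module.Finite.of_injective
    (LinearMap.pi fun i : Fin b => LinearMap.pi fun j : Fin a => S.coeff i j)
    ((injective_iff_map_eq_zero _).2 fun w hw => ?_)
  rw [← S.sum_coeff w]
  refine Finset.sum_eq_zero fun i hi => Finset.sum_eq_zero fun j hj => ?_
  have := congrFun (congrFun hw ⟨i, Finset.mem_range.1 hi⟩) ⟨j, Finset.mem_range.1 hj⟩
  simp only [LinearMap.pi_apply] at this
  rw [this]
  exact zero_smul _ _

/-- The isomorphism `A → D(A)` given by the Frobenius form. -/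
noncomputable def frobeniusIso : FrobeniusIso k A where
  toLinearEquiv :=
    haveI := S.finite
    LinearMap.linearEquivOfInjective ((LinearMap.mul k A).flip.compr₂ S.form)
      ((injective_iff_map_eq_zero _).2 fun w hw =>
        S.eq_zero_of_form hq0 fun l => by simpa using LinearMap.congr_fun hw l)
      Subspace.dual_finrank_eq.symm
  map_mul' x l y := by
    change S.form (y * (x * l)) = S.form (y * x * l)
    rw [mul_assoc]

theorem frobeniusIso_apply (l y : A) :
    (S.frobeniusIso hq0).toLinearEquiv l y = S.form (y * l) := rfl

variable {σ : A ≃ₐ[k] A} (hσx : σ S.x = q ^ (b - 1) • S.x)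
  (hσy : σ S.y = (q ^ (a - 1))⁻¹ • S.y)

include hq0 hσx hσy in
theorem form_mul_apply (r l : A) : S.form (l * σ r) = S.form (r * l) := by
  let p : Subalgebra k A :=
    { carrier := {r | ∀ l, S.form (l * σ r) = S.form (r * l)}
      mul_mem' := fun {r s} hr hs l => by
        rw [map_mul σ, ← mul_assoc, hs, ← mul_assoc, hr, mul_assoc]
      add_mem' := fun {r s} hr hs l => by
        rw [map_add σ, mul_add, map_add, hr, hs, add_mul, map_add]
      algebraMap_mem' := fun c l => by rw [AlgEquiv.commutes, Algebra.commutes] }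
  refine S.mem_subalgebra (p := p) ?_ ?_ r l
  · intro l
    suffices h : q ^ (b - 1) • S.form ∘ₗ mulRight k S.x = S.form ∘ₗ mulLeft k S.x by
      have := LinearMap.congr_fun h l
      simpa [hσx] using this
    refine S.linearMap_ext fun i j hi hj => ?_
    rw [LinearMap.smul_apply, LinearMap.comp_apply, LinearMap.comp_apply, S.mulRight_x_monomial,
      S.mulLeft_x_monomial, map_smul, form, S.coeff_monomial]
    -- Only monomials with `i = b - 1` contribute, and there left multiplication by `x` costs
    -- `qᵇ⁻¹`; this dictates the scalar in `hσx`. In the same way `j = a - 1` dictates `hσy`.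
    by_cases h : b - 1 = i
    · rw [h]
    · rw [if_neg (by omega)]; simp
  · intro l
    suffices h : (q ^ (a - 1))⁻¹ • S.form ∘ₗ mulRight k S.y = S.form ∘ₗ mulLeft k S.y by
      have := LinearMap.congr_fun h l
      simpa [hσy] using this
    refine S.linearMap_ext fun i j hi hj => ?_
    rw [LinearMap.smul_apply, LinearMap.comp_apply, LinearMap.comp_apply, S.mulRight_y_monomial,
      S.mulLeft_y_monomial, map_smul, form, S.coeff_monomial]
    by_cases h : a - 1 = j
    · rw [h, smul_smul, inv_mul_cancel₀ (pow_ne_zero _ hq0), one_smul]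
    · rw [if_neg (by omega)]; simp

include hσx hσy in
theorem frobeniusIso_isNakayama : (S.frobeniusIso hq0).IsNakayama σ.symm := fun l r => by
  rw [frobeniusIso_apply, frobeniusIso_apply, mul_one, mul_one,
    ← S.form_mul_apply hq0 hσx hσy (σ.symm r) l, AlgEquiv.apply_symm_apply]

include hq0 hσx hσy in
/-- Every Nakayama automorphism is the standard one up to conjugation by a unit. -/
theorem exists_conj_of_isNakayama {φ : FrobeniusIso k A} {ν : A ≃ₐ[k] A} (h : φ.IsNakayama ν) :
    ∃ w : A, (∀ u, ν.symm u * w = w * σ u) ∧ Function.Bijective (fun t => w * t) := by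
  obtain ⟨w, hw⟩ := (S.frobeniusIso hq0).toLinearEquiv.surjective (φ.toLinearEquiv 1)
  have hφ (t : A) : φ.toLinearEquiv 1 t = S.form (t * w) := by rw [← hw, frobeniusIso_apply]
  refine ⟨w, fun u => ?_, ?_⟩
  · rw [← sub_eq_zero]
    refine S.eq_zero_of_form hq0 fun l => ?_
    have := h l (ν.symm u)
    rw [hφ, hφ, AlgEquiv.apply_symm_apply, mul_assoc u,
      ← S.form_mul_apply hq0 hσx hσy u (l * w)] at this
    rw [mul_sub, map_sub, ← mul_assoc, this, mul_assoc, sub_self]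
  · obtain ⟨l, hl⟩ := φ.toLinearEquiv.surjective S.form
    -- The element `l` that `φ` sends to the standard form is a left inverse of `w`; finite
    -- dimension then gives bijectivity.
    have hlw : l * w = 1 := by
      rw [← sub_eq_zero]
      refine S.eq_zero_of_form hq0 fun t => ?_
      have h1 : φ.toLinearEquiv l t = φ.toLinearEquiv 1 (t * l) := by
        have := φ.map_mul' l 1 t
        rwa [mul_one] at this
      rw [hl, hφ, mul_assoc] at h1
      rw [mul_sub, map_sub, mul_one, ← h1, sub_self]
    have hinj : Function.Injective (mulLeft k w) := fun s t hst => by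
      have : l * (w * s) = l * (w * t) := congrArg (l * ·) hst
      rwa [← mul_assoc, ← mul_assoc, hlw, one_mul, one_mul] at this
    have := S.finite
    exact ⟨hinj, LinearMap.surjective_of_injective hinj⟩

include hq0 hσx hσy in
theorem tmul_sub_mem (u v : A) : (tmul u v - tmul (u * σ.symm v) 1 : FreeBimodule k A) ∈
    range (S.subY (q ^ (a - 1))⁻¹) ⊔ range (S.subX (b - 1)) := by
  set R := range (S.subY (q ^ (a - 1))⁻¹) ⊔ range (S.subX (b - 1))
  have hsx : σ.symm S.x = (q ^ (b - 1))⁻¹ • S.x := by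
    rw [AlgEquiv.symm_apply_eq, map_smul, hσx, smul_smul,
      inv_mul_cancel₀ (pow_ne_zero _ hq0), one_smul]
  have hsy : σ.symm S.y = q ^ (a - 1) • S.y := by
    rw [AlgEquiv.symm_apply_eq, map_smul, hσy, smul_smul,
      mul_inv_cancel₀ (pow_ne_zero _ hq0), one_smul]
  -- The spare right factor `t` makes the condition stable under products; the generators `x` and
  -- `y` satisfy it by the two relations.
  let p : Subalgebra k A :=
    { carrier := {v | ∀ u t, (FreeBimodule.mk u (v * t) - FreeBimodule.mk (u * σ.symm v) t : FreeBimodule k A) ∈ R}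
      mul_mem' := fun {v w} hv hw u t => by
        have := add_mem (hv u (w * t)) (hw (u * σ.symm v) t)
        rwa [sub_add_sub_cancel, ← mul_assoc, mul_assoc u, ← map_mul] at this
      add_mem' := fun {v w} hv hw u t => by
        have := add_mem (hv u t) (hw u t)
        rw [map_add, add_mul, mul_add, map_add, map_add, LinearMap.add_apply]
        convert this using 1
        abel
      algebraMap_mem' := fun c u t => by
        rw [AlgEquiv.commutes, ← Algebra.smul_def, ← Algebra.commutes, ← Algebra.smul_def,
          map_smul, map_smul, LinearMap.smul_apply, sub_self]
        exact zero_mem _ }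
  have := S.mem_subalgebra (p := p) (fun u t => ?_) (fun u t => ?_) v u 1
  · rwa [mul_one] at this
  · have h1 : S.subX (b - 1) (FreeBimodule.mk u t) ∈ R := Submodule.mem_sup_right ⟨_, rfl⟩
    have := R.smul_mem (-(q ^ (b - 1))⁻¹) h1
    convert this using 1
    rw [hsx, mul_smul_comm, map_smul, LinearMap.smul_apply, subX, LinearMap.sub_apply,
      LinearMap.smul_apply, mk_apply, mk_apply, mk_apply, map_tmul, map_tmul, smul_sub, smul_smul,
      neg_mul, inv_mul_cancel₀ (pow_ne_zero _ hq0), neg_smul, neg_smul, one_smul]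
    simp [sub_eq_add_neg, add_comm]
  · have h1 : S.subY (q ^ (a - 1))⁻¹ (FreeBimodule.mk u t) ∈ R := Submodule.mem_sup_left ⟨_, rfl⟩
    have := R.smul_mem (-(q ^ (a - 1))) h1
    convert this using 1
    rw [hsy, mul_smul_comm, map_smul, LinearMap.smul_apply, subY, LinearMap.sub_apply,
      LinearMap.smul_apply, mk_apply, mk_apply, mk_apply, map_tmul, map_tmul, smul_sub, smul_smul,
      neg_mul, mul_inv_cancel₀ (pow_ne_zero _ hq0), neg_smul, neg_smul, one_smul]
    simp [sub_eq_add_neg, add_comm]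

variable (σ) in
/-- The linear map `u ⊗ v ↦ w σ(u) v` from the free bimodule. -/
noncomputable def twistedMul (w : A) : FreeBimodule k A →ₗ[k] A :=
  FreeBimodule.lift (LinearMap.mul k A ∘ₗ mulLeft k w ∘ₗ σ.toLinearMap)

@[simp] theorem twistedMul_tmul (w u v : A) :
    twistedMul σ w (tmul u v : FreeBimodule k A) = w * σ u * v := by
  simp [twistedMul]

include hσx in
theorem twistedMul_subX (w : A) (z : FreeBimodule k A) :
    twistedMul σ w (S.subX (b - 1) z) = 0 := by
  induction z using FreeBimodule.induction with
  | hadd z t hz ht => simp only [map_add, hz, ht, add_zero]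
  | htmul u v => simp [subX, hσx, mul_assoc]

include hσy in
theorem twistedMul_subY (w : A) (z : FreeBimodule k A) :
    twistedMul σ w (S.subY (q ^ (a - 1))⁻¹ z) = 0 := by
  induction z using FreeBimodule.induction with
  | hadd z t hz ht => simp only [map_add, hz, ht, add_zero]
  | htmul u v => simp [subY, hσy, mul_assoc]

include hq0 hσx hσy in
-- Modulo the relations every element equals `σ⁻¹(twistedMul σ 1 z) ⊗ 1`, and injectivity of
-- multiplication by `w` forces this representative to vanish.
theorem mem_of_twistedMul_eq_zero {w : A} (hw : Function.Injective (fun t => w * t))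
    {z : FreeBimodule k A} (hz : twistedMul σ w z = 0) :
    z ∈ range (S.subY (q ^ (a - 1))⁻¹) ⊔ range (S.subX (b - 1)) := by
  have h1 (z : FreeBimodule k A) : z - FreeBimodule.mk (σ.symm (twistedMul σ 1 z)) 1 ∈
      range (S.subY (q ^ (a - 1))⁻¹) ⊔ range (S.subX (b - 1)) := by
    induction z using FreeBimodule.induction with
    | hadd z t hz ht =>
      have := add_mem hz ht
      simp only [map_add, LinearMap.add_apply]
      convert this using 1
      abel
    | htmul u v => simpa using S.tmul_sub_mem hq0 hσx hσy u v
  have h2 (z : FreeBimodule k A) : twistedMul σ w z = w * twistedMul σ 1 z := by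
    induction z using FreeBimodule.induction with
    | hadd z t hz ht => simp only [map_add, hz, ht, mul_add]
    | htmul u v => simp [mul_assoc]
  have h3 : twistedMul σ 1 z = 0 := hw (by simp [← h2, hz])
  simpa [h3] using h1 z

end Frobenius

end QuantumData

/-! ### Diagonal automorphisms and the final assembly. -/

namespace QuantumCI

variable {k : Type*} [Field k] {q : k} {a b : ℕ}

/-- The endomorphism `X ↦ α X`, `Y ↦ β Y`. -/
noncomputable def scaleHom (q : k) (a b : ℕ) (α β : k) : QuantumCI q a b →ₐ[k] QuantumCI q a b :=
  lift (α • x) (β • y) (by rw [smul_pow, x_pow, smul_zero])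
    (by rw [smul_mul_smul_comm, smul_mul_smul_comm, x_mul_y, smul_comm, mul_comm])
    (by rw [smul_pow, y_pow, smul_zero])

/-- The automorphism `X ↦ α X`, `Y ↦ β Y`. -/
noncomputable def scaleEquiv (q : k) (a b : ℕ) {α β : k} (hα : α ≠ 0) (hβ : β ≠ 0) :
    QuantumCI q a b ≃ₐ[k] QuantumCI q a b :=
  AlgEquiv.ofAlgHom (scaleHom q a b α β) (scaleHom q a b α⁻¹ β⁻¹)
    (algHom_ext (by simp [scaleHom, smul_smul, hα]) (by simp [scaleHom, smul_smul, hβ]))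
    (algHom_ext (by simp [scaleHom, smul_smul, hα]) (by simp [scaleHom, smul_smul, hβ]))

theorem scaleEquiv_x {α β : k} (hα : α ≠ 0) (hβ : β ≠ 0) :
    scaleEquiv q a b hα hβ x = α • x := lift_x

theorem scaleEquiv_y {α β : k} (hα : α ≠ 0) (hβ : β ≠ 0) :
    scaleEquiv q a b hα hβ y = β • y := lift_y

end QuantumCI

theorem QuantumData.subsingleton_hochschildHomology {k : Type*} [Field k] {q : k} {a b : ℕ}
    {A : Type*} [Ring A] [Algebra k A] (S : QuantumData k q a b A) (ha : 2 ≤ a) (hb : 2 ≤ b)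
    (hq0 : q ≠ 0) (hq : ∀ m : ℕ, 1 ≤ m → q ^ m ≠ 1) {σ : A ≃ₐ[k] A}
    (hσx : σ S.x = q ^ (b - 1) • S.x) (hσy : σ S.y = (q ^ (a - 1))⁻¹ • S.y)
    {φ : FrobeniusIso k A} {ν : A ≃ₐ[k] A} (h : φ.IsNakayama ν) {n : ℕ} (hn : 1 ≤ n) :
    Subsingleton (HochschildHomology k A (TwistedBimodule ν⁻¹ 1 A) n) := by
  obtain ⟨m, rfl⟩ := Nat.exists_eq_add_of_le' hn
  obtain ⟨w, hw, hbij⟩ := S.exists_conj_of_isNakayama hq0 hσx hσy h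
  rw [Submodule.Quotient.subsingleton_iff, eq_top_iff]
  rintro ⟨z, hz⟩ -
  have hc0 : (q ^ (a - 1))⁻¹ ≠ 0 := inv_ne_zero (pow_ne_zero _ hq0)
  have hc : (q ^ (a - 1))⁻¹ ≠ 1 := inv_ne_one.2 (hq _ (by omega))
  have hcb : (q ^ (a - 1))⁻¹ ^ b ≠ 1 := by
    rw [inv_pow, ← pow_mul]
    exact inv_ne_one.2 (hq _ (Nat.mul_pos (by omega) (by omega)))
  -- The generator `1 ⊗ 1` goes to `w`; the relation `ν⁻¹(u) w = w σ(u)` is what makes `π` linear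
  -- for the twisted left action.
  let π : FreeBimodule k A →ₗ[k] TwistedBimodule ν⁻¹ 1 A := QuantumData.twistedMul σ w
  refine S.mem_boundaries_of_cyclic hq0 hq hc0 hc hcb (s := b - 1) (by omega) π ?_ ?_ ?_
    (S.twistedMul_subX hσx w) (S.twistedMul_subY hσy w)
    (fun z hz => S.mem_of_twistedMul_eq_zero hq0 hσx hσy hbij.1 hz) m z hz
  · intro l z
    change QuantumData.twistedMul σ w (l • z) = ν.symm l * QuantumData.twistedMul σ w z
    induction z using FreeBimodule.induction with
    | hadd z t hz ht => rw [smul_add, map_add, map_add, mul_add, hz, ht]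
    | htmul u v =>
      rw [FreeBimodule.smul_tmul, QuantumData.twistedMul_tmul, QuantumData.twistedMul_tmul,
        map_mul, ← mul_assoc, ← mul_assoc, ← mul_assoc, hw]
  · intro r z
    induction r using MulOpposite.rec' with | h r => ?_
    change QuantumData.twistedMul σ w (MulOpposite.op r • z) = QuantumData.twistedMul σ w z * r
    induction z using FreeBimodule.induction with
    | hadd z t hz ht => rw [smul_add, map_add, map_add, add_mul, hz, ht]
    | htmul u v =>
      rw [FreeBimodule.op_smul_tmul, QuantumData.twistedMul_tmul, QuantumData.twistedMul_tmul]
      exact (mul_assoc (w * σ u) v r).symm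
  · intro t
    obtain ⟨v, hv⟩ := hbij.2 t
    exact ⟨FreeBimodule.tmul 1 v, (QuantumData.twistedMul_tmul w 1 v).trans (by simpa using hv)⟩

theorem proposition4p9 {k : Type*} [Field k] (a b : ℕ) (ha : 2 ≤ a) (hb : 2 ≤ b)
    (q : k) (hq0 : q ≠ 0) (hq : ∀ m : ℕ, 1 ≤ m → q ^ m ≠ 1) :
    (∃ (φ : FrobeniusIso k (QuantumCI q a b)) (ν : QuantumCI q a b ≃ₐ[k] QuantumCI q a b),
      φ.IsNakayama ν) ∧
    ∀ (φ : FrobeniusIso k (QuantumCI q a b)) (ν : QuantumCI q a b ≃ₐ[k] QuantumCI q a b),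
      φ.IsNakayama ν → ∀ n : ℕ, 1 ≤ n →
        Subsingleton (HochschildHomology k (QuantumCI q a b)
          (TwistedBimodule ν⁻¹ 1 (QuantumCI q a b)) n) := by
  have : Fact (0 < a) := ⟨by omega⟩
  have : Fact (0 < b) := ⟨by omega⟩
  have hα : q ^ (b - 1) ≠ 0 := pow_ne_zero _ hq0
  have hβ : (q ^ (a - 1))⁻¹ ≠ 0 := inv_ne_zero (pow_ne_zero _ hq0)
  have hσx := QuantumCI.scaleEquiv_x (q := q) (a := a) (b := b) hα hβ
  have hσy := QuantumCI.scaleEquiv_y (q := q) (a := a) (b := b) hα hβ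
  exact ⟨⟨_, _, (QuantumCI.quantumData q a b).frobeniusIso_isNakayama hq0 hσx hσy⟩,
    fun φ ν h n hn => (QuantumCI.quantumData q a b).subsingleton_hochschildHomology ha hb hq0 hq
      hσx hσy h hn⟩
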